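/- There is a polynomial-time algorithm for the subgroup into-conjugacy problem in finitely generated free groups. Precisely: there are a single Turing machine $M$ with finitely many states, a finite input alphabet and finitely many stacks (equivalently, tapes) and a polynomial $p$ with the following property. Let $n \ge 0$, let $F_n$ be the free group with basis $x_0,\dots,x_{n-1}$, and let $u_1,\dots,u_r$ and $v_1,\dots,v_s$ ($r,s\ge 0$) be words, not necessarily reduced, in the letters $x_0^{\pm1},\dots,x_{n-1}^{\pm1}$. Put $H_1=\langle u_1,\dots,u_r\rangle\leqslant F_n$ and $H_2=\langle v_1,\dots,v_s\rangle\leqslant F_n$. Started on the string that encodes $(n;\,u_1,\dots,u_r;\,v_1,\dots,v_s)$, where $n$ is written in binary, each letter is written as its index in binary followed by its exponent, and the rank, the words and the two lists are closed by end marks, $M$ halts after at most $p(\ell)$ steps, where $\ell$ is the length of this string, and its output is "true" if there is $g\in F_n$ such that $g^{-1}H_1g\leqslant H_2$, and "false" otherwise. -/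

import Mathlib

/-- An input of the subgroup into-conjugacy problem in finitely generated free groups: the rank of
the free group `F = FreeGroup (Fin rank)` and two finite lists of words over its basis and the
inverses of the basis elements (`(i, true)` is `xᵢ`, `(i, false)` is `xᵢ⁻¹`). The words need not be
reduced, and the lists and the words may be empty. -/
structure IntoConjInput where
  rank : ℕ
  gens₁ : List (List (Fin rank × Bool))
  gens₂ : List (List (Fin rank × Bool))

/-- The subgroup of the free group generated by a finite list of words. -/
def subgroupOfWords {n : ℕ} (gens : List (List (Fin n × Bool))) : Subgroup (FreeGroup (Fin n)) :=
  Subgroup.closure {x | ∃ w ∈ gens, FreeGroup.mk w = x}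

/-- `H₁` is conjugate into `H₂`: there is `g` with `g⁻¹ H₁ g ≤ H₂`. -/
def IsConjInto {G : Type*} [Group G] (H₁ H₂ : Subgroup G) : Prop :=
  ∃ g : G, H₁.map (MulAut.conj g⁻¹).toMonoidHom ≤ H₂

/-- The finite input alphabet: binary digits, the two exponents `1` and `-1` (each of them ends a
letter), and end marks for the rank, for a word, and for a list of words. -/
inductive InputSymbol : Type
  | bit (b : Bool)
  | exponent (positive : Bool)
  | endRank
  | endWord
  | endList
  deriving DecidableEq

/-- A natural number in binary. -/
def encodeBinary (m : ℕ) : List InputSymbol :=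
  (Computability.encodeNat m).map InputSymbol.bit

/-- A letter `xᵢ` or `xᵢ⁻¹`: the index `i` in binary, then the exponent. -/
def encodeLetter {n : ℕ} (l : Fin n × Bool) : List InputSymbol :=
  encodeBinary l.1 ++ [InputSymbol.exponent l.2]

/-- A word: its letters in order, then an end mark. -/
def encodeWord {n : ℕ} (w : List (Fin n × Bool)) : List InputSymbol :=
  w.flatMap encodeLetter ++ [InputSymbol.endWord]

/-- A list of words: the words in order, then an end mark. -/
def encodeWords {n : ℕ} (ws : List (List (Fin n × Bool))) : List InputSymbol :=
  ws.flatMap encodeWord ++ [InputSymbol.endList]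

/-- The string that is written on the input tape: the rank in binary, then the two lists. -/
def encodeIntoConjInput (I : IntoConjInput) : List InputSymbol :=
  encodeBinary I.rank ++ [InputSymbol.endRank] ++ encodeWords I.gens₁ ++ encodeWords I.gens₂

/-!
# Conjugacy of a subgroup into another subgroup of a free group is decidable in polynomial time

**The decision procedure.** Let `H` be the subgroup generated by the words `vs`. There is a `g`
with `g⁻¹ ⟨us⟩ g ≤ H` if and only if some coset of `H` is fixed by all the words `us`
(`isConjInto_iff`). The cosets are made accessible by Stallings' folded graph of `H`. Its vertices
are suffixes of the words `vs`; a suffix `r` stands for the coset `H r⁻¹`, which is the coset of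
the prefix that precedes `r`, so that the bouquet of the cycles `vs` (`bouquet`) needs no fresh
names for its vertices. Pairs of edges with the same source and the same label are folded by
renaming vertices until none are left (`foldGraph`, `isFolded_foldGraph`). The full coset graph of
`H` has trees attached to the folded graph. A *state* `(p, s)` is a vertex `p` of the folded graph
with a reduced path `s` into one of these trees, and `readLetter` moves from state to state. Every
letter acts invertibly (`readLetter_invLetter`), hence words act through the free group
(`readWord_eq_of_mk_eq`), and the elements of `H` fix the base state (`readWord_base_of_mem`). In
the other direction each state has a coset, in a way that is compatible with the action
(`cosetOf_readWord`). So a fixed coset exists if and only if a fixed state exists. If some `u` in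
`us` is not trivial, then the path of `u` from a fixed state back to itself must visit the graph
itself: inside a tree a closed path is contractible (`readWord_outside`). Thus the fixed state
arises from a vertex of the graph by reading a suffix of `u`, and only polynomially many states
have to be tested (`decideIntoConj_iff`).

**The machine.** Data are binary trees, written on a stack in prefix code. `Prog` is a small
structured language over four stacks, and `Run.reaches` compiles it to a multi-stack Turing
machine, step by step. A function between types that are represented by trees is `PolyTime` if a
program replaces the code of the argument on top of the main stack by the code of the value,
whatever lies below, in polynomial time. As the rest of the stack is left alone, such functions
can be composed and paired, and they are closed under recursion on lists if the intermediate
results stay of polynomial size (`PolyTime.foldTails_of_invariant`). The decision procedure is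
assembled from these operations (`PolyTime.decideIntoConj`). Folding a graph creates no new
vertices, and reading a letter enlarges a state only by an amount that does not depend on the
state, which controls the sizes. Finally `decideMachine` transfers the input string to the main
stack, runs the program, and leaves nothing but the answer.

Letters are indexed by binary numbers instead of elements of `Fin n`; this does not affect
conjugacy, as `FreeGroup (Fin n)` is a retract of the free group on all binary strings
(`isConjInto_map_iff`).
-/

/-! ### Stack programs -/

namespace IntoConj

/-- The working stacks: `main` holds the data, the others are scratch space. -/
inductive Stack : Type
  | main | a | b | c
  deriving DecidableEq

instance : Fintype Stack := ⟨{.main, .a, .b, .c}, fun k => by cases k <;> simp⟩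

/-- The contents of the working stacks, top symbol first. -/
structure Mem where
  main : List Bool
  a : List Bool
  b : List Bool
  c : List Bool

/-- The contents of one stack. -/
def Mem.get (m : Mem) : Stack → List Bool
  | .main => m.main
  | .a => m.a
  | .b => m.b
  | .c => m.c

/-- Replaces the contents of one stack. -/
def Mem.set (m : Mem) : Stack → List Bool → Mem
  | .main, l => { m with main := l }
  | .a, l => { m with a := l }
  | .b, l => { m with b := l }
  | .c, l => { m with c := l }

/-- The total number of symbols on the working stacks. -/
def Mem.total (m : Mem) : ℕ := m.main.length + m.a.length + m.b.length + m.c.length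

/-- A structured programming language over the working stacks. `case` and `loop` pop a symbol from
a stack: `case k p q r` continues with `p` if the stack was empty, with `q` if the symbol was
`false` and with `r` if it was `true`; `loop k q r` stops if the stack was empty, and otherwise runs
`q` or `r` in the same way and starts again. -/
inductive Prog : Type
  | skip
  | push (k : Stack) (x : Bool)
  | seq (p q : Prog)
  | case (k : Stack) (p q r : Prog)
  | loop (k : Stack) (q r : Prog)

/-- `p ;; q` runs `p` and then `q`. -/
infixr:60 ";;" => Prog.seq

/-- `Run p m m' t`: started on `m`, the program `p` stops after exactly `t` steps with `m'`. -/
inductive Run : Prog → Mem → Mem → ℕ → Prop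
  | skip (m) : Run .skip m m 1
  | push (k x m) : Run (.push k x) m (m.set k (x :: m.get k)) 1
  | seq {p q m m₁ m₂ s t} : Run p m m₁ s → Run q m₁ m₂ t → Run (p ;; q) m m₂ (s + t)
  | caseNil {k p q r m m' t} : m.get k = [] → Run p m m' t → Run (.case k p q r) m m' (t + 1)
  | caseCons {k p q r m m' t x l} : m.get k = x :: l → Run (bif x then r else q) (m.set k l) m' t →
      Run (.case k p q r) m m' (t + 1)
  | loopNil {k q r m} : m.get k = [] → Run (.loop k q r) m m 1
  | loopCons {k q r m m₁ m' s t x l} : m.get k = x :: l →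
      Run (bif x then r else q) (m.set k l) m₁ s → Run (.loop k q r) m₁ m' t →
      Run (.loop k q r) m m' (s + t + 1)

theorem Mem.total_set (m : Mem) (k : Stack) (l : List Bool) :
    (m.set k l).total + (m.get k).length = m.total + l.length := by
  cases k <;> simp only [Mem.total, Mem.set, Mem.get] <;> omega

/-- A step pushes at most one symbol. -/
theorem Run.total_le {p m m' t} (h : Run p m m' t) : m'.total ≤ m.total + t := by
  induction h with
  | skip | loopNil => omega
  | push k x m => have := m.total_set k (x :: m.get k); simp at this; omega
  | seq _ _ h₁ h₂ => omega
  | caseNil _ _ h => omega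
  | @caseCons k p q r m m' t x l e _ h =>
    have := m.total_set k l; rw [e] at this; simp at this; omega
  | @loopCons k q r m m₁ m' s t x l e _ _ h h' =>
    have := m.total_set k l; rw [e] at this; simp at this; omega

/-! ### Compilation of stack programs to Turing machines -/

instance : Fintype InputSymbol :=
  ⟨{.bit true, .bit false, .exponent true, .exponent false, .endRank, .endWord, .endList}, by
    rintro ((_ | _) | (_ | _) | _ | _ | _) <;> simp⟩

/-- The alphabet of a stack of the machine: the extra stack `none` holds the input. -/
abbrev Alphabet : Option Stack → Type
  | none => InputSymbol
  | some _ => Bool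

/-- The stacks of the machine, given the rest of the input and the working stacks. -/
def machineStacks (i : List InputSymbol) (m : Mem) : ∀ k, List (Alphabet k)
  | none => i
  | some k => m.get k

/-- Changing a working stack of the machine changes the memory accordingly. -/
theorem update_machineStacks (i : List InputSymbol) (m : Mem) (k : Stack) (l : List Bool) :
    Function.update (machineStacks i m) (some k) l = machineStacks i (m.set k l) := by
  funext k'
  by_cases h : k' = some k
  · subst h
    exact (Function.update_self _ _ _).trans (by cases k <;> rfl)
  · refine (Function.update_of_ne h _ _).trans ?_
    rcases k' with _ | k'
    · rfl
    · cases k <;> cases k' <;> first | rfl | exact absurd rfl h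

theorem update_machineStacks_input (i i' : List InputSymbol) (m : Mem) :
    Function.update (machineStacks i m) none i' = machineStacks i' m := by
  funext k'
  rcases k' with _ | k'
  · exact Function.update_self _ _ _
  · exact Function.update_of_ne (by simp) _ _

/-- A statement of the machine. The state of the machine is the symbol that was read last; binary
symbols are stored as input symbols. -/
abbrev MStmt (Λ : Type) := Turing.TM2.Stmt Alphabet Λ (Option InputSymbol)

/-- The labels of the compiled program. -/
def Prog.Label : Prog → Type
  | .skip => Unit
  | .push _ _ => Unit
  | .seq p q => p.Label ⊕ q.Label
  | .case _ p q r => Unit ⊕ p.Label ⊕ q.Label ⊕ r.Label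
  | .loop _ q r => Unit ⊕ q.Label ⊕ r.Label

noncomputable instance Prog.fintypeLabel : (p : Prog) → Fintype p.Label
  | .skip => inferInstanceAs (Fintype Unit)
  | .push _ _ => inferInstanceAs (Fintype Unit)
  | .seq p q =>
    haveI := fintypeLabel p; haveI := fintypeLabel q
    inferInstanceAs (Fintype (p.Label ⊕ q.Label))
  | .case _ p q r =>
    haveI := fintypeLabel p; haveI := fintypeLabel q; haveI := fintypeLabel r
    inferInstanceAs (Fintype (Unit ⊕ p.Label ⊕ q.Label ⊕ r.Label))
  | .loop _ q r =>
    haveI := fintypeLabel q; haveI := fintypeLabel r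
    inferInstanceAs (Fintype (Unit ⊕ q.Label ⊕ r.Label))

/-- The label where the compiled program starts. -/
def Prog.entry : (p : Prog) → p.Label
  | .skip => ()
  | .push _ _ => ()
  | .seq p _ => .inl p.entry
  | .case _ _ _ _ => .inl ()
  | .loop _ _ _ => .inl ()

/-- Pops a symbol from a working stack and jumps accordingly. -/
def popGoto {Λ : Type} (k : Stack) (ifNil ifFalse ifTrue : Λ) : MStmt Λ :=
  .pop (some k) (fun _ (x : Option Bool) => x.map InputSymbol.bit) <|
    .goto fun
      | some (.bit true) => ifTrue
      | some (.bit false) => ifFalse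
      | _ => ifNil

/-- The statement at a label of the compiled program, which is part of a machine with label type
`Λ` by way of `emb`, and which jumps to `exit` when it is done. -/
def Prog.stmt : (p : Prog) → {Λ : Type} → (p.Label → Λ) → Λ → p.Label → MStmt Λ
  | .skip, _, _, exit, _ => .goto fun _ => exit
  | .push k x, _, _, exit, _ => .push (some k) (fun _ => x) <| .goto fun _ => exit
  | .seq p q, _, emb, _, .inl l => p.stmt (emb ∘ .inl) (emb (.inr q.entry)) l
  | .seq _ q, _, emb, exit, .inr l => q.stmt (emb ∘ .inr) exit l
  | .case k p q r, _, emb, _, .inl _ =>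
    popGoto k (emb (.inr (.inl p.entry))) (emb (.inr (.inr (.inl q.entry))))
      (emb (.inr (.inr (.inr r.entry))))
  | .case _ p _ _, _, emb, exit, .inr (.inl l) => p.stmt (emb ∘ .inr ∘ .inl) exit l
  | .case _ _ q _, _, emb, exit, .inr (.inr (.inl l)) =>
    q.stmt (emb ∘ .inr ∘ .inr ∘ .inl) exit l
  | .case _ _ _ r, _, emb, exit, .inr (.inr (.inr l)) =>
    r.stmt (emb ∘ .inr ∘ .inr ∘ .inr) exit l
  | .loop k q r, _, emb, exit, .inl _ =>
    popGoto k exit (emb (.inr (.inl q.entry))) (emb (.inr (.inr r.entry)))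
  | .loop _ q _, _, emb, _, .inr (.inl l) => q.stmt (emb ∘ .inr ∘ .inl) (emb (.inl ())) l
  | .loop _ _ r, _, emb, _, .inr (.inr l) => r.stmt (emb ∘ .inr ∘ .inr) (emb (.inl ())) l

/-- `Reaches M n c c'`: the machine `M` gets from `c` to `c'` in exactly `n` steps. -/
def Reaches {Λ : Type} (M : Λ → MStmt Λ) (n : ℕ)
    (c c' : Turing.TM2.Cfg Alphabet Λ (Option InputSymbol)) : Prop :=
  (flip bind (Turing.TM2.step M))^[n] (some c) = some c'

theorem Reaches.trans {Λ : Type} {M : Λ → MStmt Λ} {n n' c c' c''} (h : Reaches M n c c')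
    (h' : Reaches M n' c' c'') : Reaches M (n + n') c c'' := by
  unfold Reaches at *
  rw [add_comm, Function.iterate_add_apply, h, h']

theorem Reaches.one {Λ : Type} {M : Λ → MStmt Λ} {l v S c} (h : Turing.TM2.stepAux (M l) v S = c) :
    Reaches M 1 ⟨some l, v, S⟩ c := by
  subst h; rfl

theorem reaches_popGoto_nil {Λ : Type} {M : Λ → MStmt Λ} {l k l₀ l₁ l₂}
    (hM : M l = popGoto k l₀ l₁ l₂) {m : Mem} (h : m.get k = []) (i v) :
    ∃ v', Reaches M 1 ⟨some l, v, machineStacks i m⟩ ⟨some l₀, v', machineStacks i m⟩ := by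
  refine ⟨none, .one ?_⟩
  have h' : machineStacks i m (some k) = [] := h
  have := update_machineStacks i m k []
  rw [hM, popGoto]
  simp only [Turing.TM2.stepAux, h', List.head?_nil, List.tail_nil]
  refine congrArg (Turing.TM2.Cfg.mk _ _) (this.trans ?_)
  cases m; cases k <;> cases h <;> rfl

theorem reaches_popGoto_cons {Λ : Type} {M : Λ → MStmt Λ} {l k l₀ l₁ l₂}
    (hM : M l = popGoto k l₀ l₁ l₂) {m : Mem} {x s} (h : m.get k = x :: s) (i v) :
    ∃ v', Reaches M 1 ⟨some l, v, machineStacks i m⟩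
      ⟨some (bif x then l₂ else l₁), v', machineStacks i (m.set k s)⟩ := by
  refine ⟨some (.bit x), .one ?_⟩
  have h' : machineStacks i m (some k) = x :: s := h
  have := update_machineStacks i m k s
  rw [hM, popGoto]
  simp only [Turing.TM2.stepAux, h', List.head?_cons, List.tail_cons]
  cases x <;> exact congrArg (Turing.TM2.Cfg.mk _ _) this

/-- A machine that contains the compiled program runs it, with one step of the machine for each step
of the program. -/
theorem Run.reaches {p m m' t} (h : Run p m m' t) :
    ∀ {Λ : Type} {M : Λ → MStmt Λ} {emb : p.Label → Λ} {exit : Λ},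
      (∀ l, M (emb l) = p.stmt emb exit l) → ∀ i v, ∃ v',
        Reaches M t ⟨some (emb p.entry), v, machineStacks i m⟩
          ⟨some exit, v', machineStacks i m'⟩ := by
  induction h with
  | skip m => exact fun hM i v => ⟨v, .one (by rw [hM]; rfl)⟩
  | push k x m =>
    intro Λ M emb exit hM i v
    refine ⟨v, .one ?_⟩
    rw [hM]
    exact congrArg (Turing.TM2.Cfg.mk _ _) (update_machineStacks i m k (x :: m.get k))
  | seq _ _ h₁ h₂ =>
    intro Λ M emb exit hM i v
    obtain ⟨v₁, r₁⟩ := h₁ (fun l => hM (.inl l)) i v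
    obtain ⟨v₂, r₂⟩ := h₂ (fun l => hM (.inr l)) i v₁
    exact ⟨v₂, r₁.trans r₂⟩
  | caseNil e _ h =>
    intro Λ M emb exit hM i v
    obtain ⟨v₁, r₁⟩ := reaches_popGoto_nil (hM (.inl ())) e i v
    obtain ⟨v₂, r₂⟩ := h (fun l => hM (.inr (.inl l))) i v₁
    exact ⟨v₂, by rw [add_comm]; exact r₁.trans r₂⟩
  | @caseCons k p q r m m' t x l e _ h =>
    intro Λ M emb exit hM i v
    obtain ⟨v₁, r₁⟩ := reaches_popGoto_cons (hM (.inl ())) e i v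
    cases x
    · obtain ⟨v₂, r₂⟩ := h (fun l => hM (.inr (.inr (.inl l)))) i v₁
      exact ⟨v₂, by rw [add_comm]; exact r₁.trans r₂⟩
    · obtain ⟨v₂, r₂⟩ := h (fun l => hM (.inr (.inr (.inr l)))) i v₁
      exact ⟨v₂, by rw [add_comm]; exact r₁.trans r₂⟩
  | loopNil e =>
    intro Λ M emb exit hM i v
    exact reaches_popGoto_nil (hM (.inl ())) e i v
  | @loopCons k q r m m₁ m' s t x l e _ _ h h' =>
    intro Λ M emb exit hM i v
    obtain ⟨v₁, r₁⟩ := reaches_popGoto_cons (hM (.inl ())) e i v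
    cases x
    · obtain ⟨v₂, r₂⟩ := h (fun l => hM (.inr (.inl l))) i v₁
      obtain ⟨v₃, r₃⟩ := h' hM i v₂
      exact ⟨v₃, by rw [add_comm]; exact r₁.trans (r₂.trans r₃)⟩
    · obtain ⟨v₂, r₂⟩ := h (fun l => hM (.inr (.inr l))) i v₁
      obtain ⟨v₃, r₃⟩ := h' hM i v₂
      exact ⟨v₃, by rw [add_comm]; exact r₁.trans (r₂.trans r₃)⟩

/-! ### Binary trees on a stack -/

/-- Binary trees, the universal data type of the programs. -/
inductive Tree : Type
  | nil
  | node (x y : Tree)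

/-- The prefix code of a tree: `false` for a leaf, `true` for a node. No code is a proper prefix of
another code, so a stack can hold several trees. -/
def Tree.enc : Tree → List Bool
  | .nil => [false]
  | .node x y => true :: (x.enc ++ y.enc)

/-- The number of symbols of the code of a tree. -/
def Tree.size : Tree → ℕ
  | .nil => 1
  | .node x y => x.size + y.size + 1

@[simp] theorem Tree.length_enc (x : Tree) : x.enc.length = x.size := by
  induction x with
  | nil => rfl
  | node x y hx hy => simp [enc, size, hx, hy]

theorem Tree.size_pos (x : Tree) : 0 < x.size := by cases x <;> simp [size]

theorem Tree.enc_append_inj {x y : Tree} {r s : List Bool} (h : x.enc ++ r = y.enc ++ s) :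
    x = y ∧ r = s := by
  induction x generalizing y r s with
  | nil =>
    cases y with
    | nil => simpa [enc] using h
    | node y₁ y₂ => simp [enc] at h
  | node x₁ x₂ h₁ h₂ =>
    cases y with
    | nil => simp [enc] at h
    | node y₁ y₂ =>
      simp only [enc, List.cons_append, List.append_assoc, List.cons.injEq, true_and] at h
      obtain ⟨rfl, h'⟩ := h₁ h
      obtain ⟨rfl, h''⟩ := h₂ h'
      exact ⟨rfl, h''⟩

theorem Tree.enc_injective : Function.Injective Tree.enc := fun x y h =>
  (enc_append_inj (r := []) (s := []) (by rw [h])).1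

/-- Started on `m`, the program `p` stops with `m'` after at most `t` steps. -/
def RunLe (p : Prog) (m m' : Mem) (t : ℕ) : Prop := ∃ s ≤ t, Run p m m' s

theorem RunLe.mono {p m m' t t'} (h : RunLe p m m' t) (ht : t ≤ t') : RunLe p m m' t' :=
  h.imp fun _ h => ⟨h.1.trans ht, h.2⟩

theorem RunLe.of_eq {p m m' m'' t t'} (h : RunLe p m m' t) (e : m' = m'') (ht : t ≤ t') :
    RunLe p m m'' t' := e ▸ h.mono ht

theorem RunLe.skip (m) : RunLe .skip m m 1 := ⟨1, le_rfl, .skip _⟩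

theorem RunLe.push (k x m) : RunLe (.push k x) m (m.set k (x :: m.get k)) 1 :=
  ⟨1, le_rfl, .push _ _ _⟩

theorem RunLe.seq {p q m m₁ m₂ s t} (hp : RunLe p m m₁ s) (hq : RunLe q m₁ m₂ t) :
    RunLe (p ;; q) m m₂ (s + t) := by
  obtain ⟨s', hs, hp⟩ := hp
  obtain ⟨t', ht, hq⟩ := hq
  exact ⟨s' + t', by omega, hp.seq hq⟩

theorem RunLe.caseNil {k p q r m m' t} (e : m.get k = []) (h : RunLe p m m' t) :
    RunLe (.case k p q r) m m' (t + 1) := by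
  obtain ⟨s, hs, h⟩ := h
  exact ⟨s + 1, by omega, h.caseNil e⟩

theorem RunLe.caseCons {k p q r m m' t x l} (e : m.get k = x :: l)
    (h : RunLe (bif x then r else q) (m.set k l) m' t) : RunLe (.case k p q r) m m' (t + 1) := by
  obtain ⟨s, hs, h⟩ := h
  exact ⟨s + 1, by omega, h.caseCons e⟩

theorem RunLe.loopNil {k q r m} (e : m.get k = []) : RunLe (.loop k q r) m m 1 :=
  ⟨1, le_rfl, .loopNil e⟩

theorem RunLe.loopCons {k q r m m₁ m' s t x l} (e : m.get k = x :: l)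
    (h : RunLe (bif x then r else q) (m.set k l) m₁ s) (h' : RunLe (.loop k q r) m₁ m' t) :
    RunLe (.loop k q r) m m' (s + t + 1) := by
  obtain ⟨s', hs, h⟩ := h
  obtain ⟨t', ht, h'⟩ := h'
  exact ⟨s' + t' + 1, by omega, h.loopCons e h'⟩

/-- Running `p` with empty scratch stacks replaces the symbols `x` on top of `main` by `y` within
`t` steps, whatever is below. -/
def Rewrites (p : Prog) (x y : List Bool) (t : ℕ) : Prop :=
  ∀ r, RunLe p ⟨x ++ r, [], [], []⟩ ⟨y ++ r, [], [], []⟩ t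

theorem Rewrites.mono {p x y t t'} (h : Rewrites p x y t) (ht : t ≤ t') : Rewrites p x y t' :=
  fun r => (h r).mono ht

theorem Rewrites.seq {p q x y z s t} (hp : Rewrites p x y s) (hq : Rewrites q y z t) :
    Rewrites (p ;; q) x z (s + t) := fun r => (hp r).seq (hq r)

theorem Rewrites.append {p x y t} (h : Rewrites p x y t) (r : List Bool) :
    Rewrites p (x ++ r) (y ++ r) t := fun r' => by
  simpa using h (r ++ r')

theorem Rewrites.push (b : Bool) (x : List Bool) : Rewrites (.push .main b) x (b :: x) 1 :=
  fun _ => .push _ _ _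

theorem Rewrites.skip (x : List Bool) : Rewrites .skip x x 1 := fun _ => .skip _

theorem Rewrites.case_false {p q r x y t} (h : Rewrites q x y t) :
    Rewrites (.case .main p q r) (false :: x) y (t + 1) := fun r' => .caseCons rfl (h r')

theorem Rewrites.case_true {p q r x y t} (h : Rewrites r x y t) :
    Rewrites (.case .main p q r) (true :: x) y (t + 1) := fun r' => .caseCons rfl (h r')

/-- The length of the result is bounded by the time. -/
theorem Rewrites.length_le {p x y t} (h : Rewrites p x y t) : y.length ≤ x.length + t := by
  obtain ⟨s, hs, h⟩ := h []
  have := h.total_le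
  simp [Mem.total] at this
  omega

/-- Pushes a list of symbols on `main`. -/
def pushAll : List Bool → Prog
  | [] => .skip
  | b :: l => pushAll l ;; .push .main b

theorem rewrites_pushAll (l x : List Bool) : Rewrites (pushAll l) x (l ++ x) (l.length + 1) := by
  induction l with
  | nil => exact .skip x
  | cons b l ih => exact ih.seq (.push b _)

/-- The loop of `moveTo`. Stack `c` holds a symbol for each subtree that is still to be read. -/
def moveLoop (k : Stack) : Prog :=
  .loop .c .skip
    (.case .main .skip (.push k false) (.push k true ;; .push .c true ;; .push .c true))

/-- Moves the tree on top of `main` to the stack `k`, in reverse. -/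
def moveTo (k : Stack) : Prog := .push .c true ;; moveLoop k

/-- The loop moves one tree for each symbol on stack `c`: a leaf takes away one of these symbols,
and a node adds one. -/
theorem runLe_moveLoop {k : Stack} (hk : k = .a ∨ k = .b) (x : Tree) {r a b c : List Bool}
    {m' : Mem} {t : ℕ}
    (h : RunLe (moveLoop k)
      ((Mem.mk r a b c).set k (x.enc.reverse ++ (Mem.mk r a b c).get k)) m' t) :
    RunLe (moveLoop k) ⟨x.enc ++ r, a, b, true :: c⟩ m' (t + 5 * x.size) := by
  induction x generalizing r a b c t with
  | nil =>
    refine RunLe.mono (.loopCons (x := true) rfl (.caseCons (x := false) rfl (.push k false _)) ?_)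
      (t := 1 + 1 + t + 1) (by simp only [Tree.size]; omega)
    rcases hk with rfl | rfl <;> exact h
  | node x y hx hy =>
    have e : (Tree.node x y).enc ++ r = true :: (x.enc ++ (y.enc ++ r)) := by simp [Tree.enc]
    rw [e]
    rcases hk with rfl | rfl
    all_goals
      refine RunLe.mono (.loopCons (x := true) rfl (.caseCons (x := true) rfl
        ((RunLe.push _ true _).seq ((RunLe.push .c true _).seq (.push .c true _)))) (hx (hy ?_)))
        (t := 1 + (1 + 1) + 1 + (t + 5 * y.size + 5 * x.size) + 1) (by simp only [Tree.size]; omega)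
      convert h using 1
      simp [Mem.set, Mem.get, Tree.enc]

theorem runLe_moveTo_a (x : Tree) (r a b : List Bool) :
    RunLe (moveTo .a) ⟨x.enc ++ r, a, b, []⟩ ⟨r, x.enc.reverse ++ a, b, []⟩ (5 * x.size + 2) :=
  (RunLe.push .c true _).seq (t := 1 + 5 * x.size) (runLe_moveLoop (.inl rfl) x (.loopNil rfl))
    |>.mono (by omega)

theorem runLe_moveTo_b (x : Tree) (r a b : List Bool) :
    RunLe (moveTo .b) ⟨x.enc ++ r, a, b, []⟩ ⟨r, a, x.enc.reverse ++ b, []⟩ (5 * x.size + 2) :=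
  (RunLe.push .c true _).seq (t := 1 + 5 * x.size) (runLe_moveLoop (.inr rfl) x (.loopNil rfl))
    |>.mono (by omega)

/-- Moves stack `a` to `main`, in reverse. -/
def moveA : Prog := .loop .a (.push .main false) (.push .main true)

theorem runLe_moveA (l r b c : List Bool) :
    RunLe moveA ⟨r, l, b, c⟩ ⟨l.reverse ++ r, [], b, c⟩ (2 * l.length + 1) := by
  induction l generalizing r with
  | nil => exact .loopNil rfl
  | cons x l ih =>
    refine RunLe.of_eq (.loopCons (x := x) rfl (m₁ := ⟨x :: r, l, b, c⟩) (s := 1) ?_ (ih _))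

      (by simp) (by simp; omega)
    cases x <;> exact .push _ _ _

/-- Moves stack `b` to `main`, in reverse. -/
def moveB : Prog := .loop .b (.push .main false) (.push .main true)

theorem runLe_moveB (l r a c : List Bool) :
    RunLe moveB ⟨r, a, l, c⟩ ⟨l.reverse ++ r, a, [], c⟩ (2 * l.length + 1) := by
  induction l generalizing r with
  | nil => exact .loopNil rfl
  | cons x l ih =>
    refine RunLe.of_eq (.loopCons (x := x) rfl (m₁ := ⟨x :: r, a, l, c⟩) (s := 1) ?_ (ih _))

      (by simp) (by simp; omega)
    cases x <;> exact .push _ _ _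

/-- Exchanges the two trees on top of `main`. -/
def swap : Prog := moveTo .a ;; moveTo .b ;; moveA ;; moveB

theorem rewrites_swap (x y : Tree) :
    Rewrites swap (x.enc ++ y.enc) (y.enc ++ x.enc) (7 * x.size + 7 * y.size + 6) := fun r => by
  rw [List.append_assoc]
  exact ((runLe_moveTo_a x _ [] []).seq ((runLe_moveTo_b y r _ []).seq
    ((runLe_moveA _ _ _ _).seq (runLe_moveB _ _ _ _)))).of_eq (by simp) (by simp; omega)

/-- Removes the tree on top of `main`. -/
def drop : Prog := moveTo .a ;; .loop .a .skip .skip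

theorem runLe_clearA (l r b c : List Bool) :
    RunLe (.loop .a .skip .skip) ⟨r, l, b, c⟩ ⟨r, [], b, c⟩ (2 * l.length + 1) := by
  induction l with
  | nil => exact .loopNil rfl
  | cons x l ih =>
    refine RunLe.mono (.loopCons (x := x) rfl (m₁ := ⟨r, l, b, c⟩) (s := 1) ?_ ih) (by simp; omega)
    cases x <;> exact .skip _

theorem rewrites_drop (x : Tree) (y : List Bool) :
    Rewrites drop (x.enc ++ y) y (7 * x.size + 3) := fun r => by
  rw [List.append_assoc]
  exact ((runLe_moveTo_a x _ [] []).seq (runLe_clearA _ _ _ _)).mono (by simp; omega)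

/-- Duplicates the tree on top of `main`. -/
def dup : Prog :=
  moveTo .a ;;
  .loop .a (.push .main false ;; .push .b false) (.push .main true ;; .push .b true) ;;
  .loop .b (.push .a false) (.push .a true) ;; moveA

theorem runLe_copyA (l r b c : List Bool) :
    RunLe (.loop .a (.push .main false ;; .push .b false) (.push .main true ;; .push .b true))
      ⟨r, l, b, c⟩ ⟨l.reverse ++ r, [], l.reverse ++ b, c⟩ (3 * l.length + 1) := by
  induction l generalizing r b with
  | nil => exact .loopNil rfl
  | cons x l ih =>
    refine RunLe.of_eq (.loopCons (x := x) rfl (m₁ := ⟨x :: r, l, x :: b, c⟩) (s := 2) ?_ (ih _ _))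

      (by simp) (by simp; omega)
    cases x <;> exact (RunLe.push _ _ _).seq (.push _ _ _)

theorem runLe_moveBA (l r a c : List Bool) :
    RunLe (.loop .b (.push .a false) (.push .a true))
      ⟨r, a, l, c⟩ ⟨r, l.reverse ++ a, [], c⟩ (2 * l.length + 1) := by
  induction l generalizing a with
  | nil => exact .loopNil rfl
  | cons x l ih =>
    refine RunLe.of_eq (.loopCons (x := x) rfl (m₁ := ⟨r, x :: a, l, c⟩) (s := 1) ?_ (ih _))

      (by simp) (by simp; omega)
    cases x <;> exact .push _ _ _

theorem rewrites_dup (x : Tree) :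
    Rewrites dup x.enc (x.enc ++ x.enc) (12 * x.size + 5) := fun r => by
  exact ((runLe_moveTo_a x _ [] []).seq ((runLe_copyA _ _ _ _).seq ((runLe_moveBA _ _ _ _).seq
    (runLe_moveA _ _ _ _)))).of_eq (by simp) (by simp; omega)

/-- Pops a symbol from `b` and marks `c` unless it is the symbol `x`. -/
def compareB (x : Bool) : Prog :=
  .case .b (.push .c true) (bif x then .push .c true else .skip)
    (bif x then .skip else .push .c true)

/-- Replaces the two trees on top of `main` by the truth value of their equality. The codes are
compared symbol by symbol; stack `c` ends up empty if and only if they agree. -/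
def eqTest : Prog :=
  moveTo .a ;; moveTo .b ;; .loop .a (compareB false) (compareB true) ;;
  .loop .b (.push .c true) (.push .c true) ;;
  .case .c (pushAll (Tree.node .nil .nil).enc) .skip
    (.loop .c .skip .skip ;; .push .main false)

/-- The comparison leaves `c` and `b` empty if and only if `c` was empty and `b` was equal to `a`
before. -/
theorem runLe_compareLoop (l l' r c : List Bool) :
    ∃ c₁ l₁, RunLe (.loop .a (compareB false) (compareB true)) ⟨r, l, l', c⟩ ⟨r, [], l₁, c₁⟩
      (3 * l.length + 1) ∧ ((c₁ = [] ∧ l₁ = []) ↔ (c = [] ∧ l = l')) ∧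
      c₁.length ≤ c.length + l.length ∧ l₁.length ≤ l'.length ∧
      ((∀ x ∈ c, x = true) → ∀ x ∈ c₁, x = true) := by
  induction l generalizing l' c with
  | nil => exact ⟨c, l', .loopNil rfl, by simp [eq_comm], by simp, by simp, id⟩
  | cons x l ih =>
    obtain ⟨c₀, h₀, h, h'⟩ : ∃ c₀, RunLe (compareB x) ⟨r, l, l', c⟩ ⟨r, l, l'.tail, c₀⟩ 2 ∧
        (c₀ = [] ↔ c = [] ∧ l'.head? = some x) ∧ (c₀ = c ∨ c₀ = true :: c) := by
      rcases l' with _ | ⟨y, l'⟩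
      · exact ⟨true :: c, .caseNil rfl (.push _ _ _), by simp, .inr rfl⟩
      · by_cases hxy : x = y
        · subst hxy
          refine ⟨c, ?_, by simp, .inl rfl⟩
          cases x <;> exact .caseCons rfl (.skip _)
        · refine ⟨true :: c, ?_, by simp [Ne.symm hxy], .inr rfl⟩
          cases x <;> cases y <;> first | exact absurd rfl hxy | exact .caseCons rfl (.push _ _ _)
    obtain ⟨c₁, l₁, h₁, h₂, h₃, h₄, h₅⟩ := ih l'.tail c₀
    refine ⟨c₁, l₁, .mono (.loopCons (x := x) rfl (m₁ := ⟨r, l, l'.tail, c₀⟩) (s := 2) ?_ h₁)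
      (by simp; omega), ?_, ?_, h₄.trans (by simp), fun hc => h₅ ?_⟩
    · cases x <;> exact h₀
    · rw [h₂, h]
      cases l' <;> simp [eq_comm, and_assoc]
    · rcases h' with rfl | rfl <;> simp at h₃ ⊢ <;> omega
    · rcases h' with rfl | rfl <;> simpa using hc

theorem runLe_markB (l r a c : List Bool) :
    RunLe (.loop .b (.push .c true) (.push .c true))
      ⟨r, a, l, c⟩ ⟨r, a, [], List.replicate l.length true ++ c⟩ (2 * l.length + 1) := by
  induction l generalizing c with
  | nil => exact .loopNil rfl
  | cons x l ih =>
    refine RunLe.of_eq (.loopCons (x := x) rfl (m₁ := ⟨r, a, l, true :: c⟩) (s := 1) ?_ (ih _))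

      (by simp [List.replicate_succ']) (by simp; omega)
    cases x <;> exact .push _ _ _

theorem runLe_clearC (l r a b : List Bool) :
    RunLe (.loop .c .skip .skip) ⟨r, a, b, l⟩ ⟨r, a, b, []⟩ (2 * l.length + 1) := by
  induction l with
  | nil => exact .loopNil rfl
  | cons x l ih =>
    refine RunLe.mono (.loopCons (x := x) rfl (m₁ := ⟨r, a, b, l⟩) (s := 1) ?_ ih) (by simp; omega)
    cases x <;> exact .skip _

/-- Truth values as trees. -/
def Tree.ofBool : Bool → Tree
  | false => .nil
  | true => .node .nil .nil

theorem rewrites_eqTest (x y : Tree) [Decidable (x = y)] :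
    Rewrites eqTest (x.enc ++ y.enc) (Tree.ofBool (decide (x = y))).enc
      (20 * x.size + 20 * y.size + 20) := fun r => by
  rw [List.append_assoc]
  obtain ⟨c₁, l₁, h₁, h₂, h₃, h₄, h₅⟩ := runLe_compareLoop x.enc.reverse y.enc.reverse r []
  have h₆ := runLe_markB l₁ r [] c₁
  have hb := runLe_moveTo_b y r x.enc.reverse []
  rw [List.append_nil] at hb
  have ha := runLe_moveTo_a x (y.enc ++ r) [] []
  rw [List.append_nil] at ha
  refine (ha.seq (hb.seq (RunLe.seq (h₁.of_eq rfl (t' := 3 * x.size + 1) (by simp))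
    (RunLe.seq (h₆.mono (t' := 2 * y.size + 1) ?_) (t := 2 * x.size + 2 * y.size + 10) ?_)))).mono
      (by omega)
  · simp at h₄; omega
  · have h₅ := h₅ (by simp)
    -- there are no marks on `c` exactly if the two codes, and so the two trees, agree
    have hiff : List.replicate l₁.length true ++ c₁ = [] ↔ x = y := by
      rw [List.append_eq_nil_iff, List.replicate_eq_nil_iff, List.length_eq_zero_iff, and_comm, h₂]
      simpa using Tree.enc_injective.eq_iff
    have ht : ∀ z ∈ List.replicate l₁.length true ++ c₁, z = true := by
      intro z hz
      rcases List.mem_append.1 hz with hz | hz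
      · exact List.eq_of_mem_replicate hz
      · exact h₅ z hz
    have hl : (List.replicate l₁.length true ++ c₁).length ≤ y.size + x.size := by
      simp at h₃ h₄ ⊢; omega
    generalize List.replicate l₁.length true ++ c₁ = l at hiff ht hl
    rcases l with _ | ⟨z, l⟩
    · rw [decide_eq_true (hiff.1 rfl)]
      exact (RunLe.caseNil rfl (rewrites_pushAll _ [] r)).mono (by simp [Tree.size])
    · obtain rfl : z = true := ht z (by simp)
      rw [decide_eq_false (fun h => by simpa using hiff.2 h)]
      refine RunLe.mono (t := 2 * l.length + 1 + 1 + 1) ?_ (by simp at hl; omega)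
      exact RunLe.caseCons (x := true) rfl ((runLe_clearC l r [] []).seq (.push .main false _))

/-! ### Functions computable in polynomial time -/

/-- A type whose elements are represented by trees. -/
class Code (α : Type) where
  toTree : α → Tree
  toTree_injective : Function.Injective toTree

/-- The code of `x` as a list of symbols. -/
def enc {α : Type} [Code α] (x : α) : List Bool := (Code.toTree x).enc

/-- The size of the code of `x`. -/
def size {α : Type} [Code α] (x : α) : ℕ := (Code.toTree x).size

@[simp] theorem length_enc {α : Type} [Code α] (x : α) : (enc x).length = size x :=
  Tree.length_enc _

instance : Code Bool := ⟨Tree.ofBool, by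
  rintro (_ | _) (_ | _) h <;> first | rfl | cases h⟩

instance {α β : Type} [Code α] [Code β] : Code (α × β) :=
  ⟨fun x => .node (Code.toTree x.1) (Code.toTree x.2), fun x y h => by
    injection h with h₁ h₂
    exact Prod.ext (Code.toTree_injective h₁) (Code.toTree_injective h₂)⟩

/-- A list as a tree: the heads hang off the right spine. -/
def listToTree {α : Type} [Code α] : List α → Tree
  | [] => .nil
  | x :: l => .node (Code.toTree x) (listToTree l)

instance {α : Type} [Code α] : Code (List α) := ⟨listToTree, fun l => by
  induction l with
  | nil => rintro (_ | ⟨y, m⟩) h <;> first | rfl | cases h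
  | cons x l ih =>
    rintro (_ | ⟨y, m⟩) h
    · cases h
    · injection h with h₁ h₂
      rw [Code.toTree_injective h₁, ih h₂]⟩

section Size

variable {α β : Type} [Code α] [Code β]

@[simp] theorem size_pair (x : α) (y : β) : size (x, y) = size x + size y + 1 := rfl

@[simp] theorem size_nil : size ([] : List α) = 1 := rfl

@[simp] theorem size_cons (x : α) (l : List α) : size (x :: l) = size x + size l + 1 := rfl

theorem size_prod (x : α × β) : size x = size x.1 + size x.2 + 1 := rfl

theorem size_pos (x : α) : 0 < size x := Tree.size_pos _

theorem length_lt_size (l : List α) : l.length < size l := by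
  induction l with
  | nil => simp
  | cons x l ih => simp; omega

theorem size_append (l m : List α) : size (l ++ m) + 1 = size l + size m := by
  induction l with
  | nil => simp; omega
  | cons x l ih => simp; omega

theorem size_le_of_mem {x : α} {l : List α} (h : x ∈ l) : size x < size l := by
  induction h with
  | head l => rw [size_cons]; omega
  | tail y _ ih => rw [size_cons]; omega

theorem size_le_of_forall_le {l : List α} {b : ℕ} (h : ∀ x ∈ l, size x ≤ b) :
    size l ≤ l.length * (b + 1) + 1 := by
  induction l with
  | nil => simp
  | cons x l ih =>
    have := ih fun y hy => h y (by simp [hy])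
    have := h x (by simp)
    simp [add_mul] at *
    omega

theorem size_le_of_suffix {l m : List α} (h : l <:+ m) : size l ≤ size m := by
  obtain ⟨k, rfl⟩ := h
  have := size_append k l
  have := size_pos k
  omega

end Size

theorem eval_mono (p : Polynomial ℕ) : Monotone fun n => p.eval n := by
  intro m n h
  simp only [Polynomial.eval_eq_sum, Polynomial.sum]
  exact Finset.sum_le_sum fun i _ => by gcongr

/-- `f` is computed by a stack program, in place on top of the stack `main`, in time polynomial in
the size of the code of the argument. -/
def PolyTime {α β : Type} [Code α] [Code β] (f : α → β) : Prop :=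
  ∃ (p : Prog) (q : Polynomial ℕ), ∀ x, Rewrites p (enc x) (enc (f x)) (q.eval (size x))

namespace PolyTime

variable {α β γ δ : Type} [Code α] [Code β] [Code γ] [Code δ]

/-- The size of the value is bounded by a polynomial in the size of the argument. -/
theorem size_le {f : α → β} (hf : PolyTime f) :
    ∃ q : Polynomial ℕ, ∀ x, size (f x) ≤ q.eval (size x) := by
  obtain ⟨p, q, h⟩ := hf
  refine ⟨.X + q, fun x => ?_⟩
  simpa using (h x).length_le

theorem of_eq {f g : α → β} (hf : PolyTime f) (h : ∀ x, f x = g x) : PolyTime g :=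
  funext h ▸ hf

theorem id : PolyTime fun x : α => x := ⟨.skip, 1, fun x => by simpa using Rewrites.skip _⟩

theorem comp {g : β → γ} {f : α → β} (hg : PolyTime g) (hf : PolyTime f) :
    PolyTime fun x => g (f x) := by
  obtain ⟨b, hb⟩ := hf.size_le
  obtain ⟨p, q, h⟩ := hf
  obtain ⟨p', q', h'⟩ := hg
  refine ⟨p ;; p', q + q'.comp b, fun x => ((h x).seq (h' (f x))).mono ?_⟩
  have := eval_mono q' (hb x)
  simpa using this

theorem const (b : β) : PolyTime fun _ : α => b := by
  refine ⟨drop ;; pushAll (enc b), .C 7 * .X + .C (size b + 4), fun x => ?_⟩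
  have h := (rewrites_drop (Code.toTree x) []).seq (rewrites_pushAll (enc b) [])
  rw [List.append_nil, List.append_nil] at h
  exact h.mono (by simp [size]; omega)

/-- The argument is duplicated, and the two functions are applied to the two copies. -/
theorem pair {f : α → β} {g : α → γ} (hf : PolyTime f) (hg : PolyTime g) :
    PolyTime fun x => (f x, g x) := by
  obtain ⟨b, hb⟩ := hf.size_le
  obtain ⟨b', hb'⟩ := hg.size_le
  obtain ⟨p, q, h⟩ := hf
  obtain ⟨p', q', h'⟩ := hg
  refine ⟨dup ;; p ;; swap ;; p' ;; swap ;; .push .main true,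
    .C 19 * .X + q + q' + .C 14 * b + .C 7 * b' + .C 20, fun x => ?_⟩
  refine ((rewrites_dup (Code.toTree x)).seq (((h x).append _).seq
    ((rewrites_swap (Code.toTree (f x)) (Code.toTree x)).seq (((h' x).append _).seq
      ((rewrites_swap (Code.toTree (g x)) (Code.toTree (f x))).seq (.push true _)))))).mono ?_
  have := hb x
  have := hb' x
  simp [size] at *
  omega

theorem fst {f : α → β × γ} (hf : PolyTime f) : PolyTime fun x => (f x).1 := by
  refine comp (g := fun y : β × γ => y.1) ⟨.case .main .skip .skip (swap ;; drop),
    .C 14 * .X + .C 20, fun x => ?_⟩ hf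
  have h := (rewrites_swap (Code.toTree x.1) (Code.toTree x.2)).seq (rewrites_drop _ _)
  have e := size_prod x
  exact Rewrites.mono (Rewrites.case_true h) (by simp [size] at e ⊢; omega)

theorem snd {f : α → β × γ} (hf : PolyTime f) : PolyTime fun x => (f x).2 := by
  refine comp (g := fun y : β × γ => y.2) ⟨.case .main .skip .skip drop,
    .C 14 * .X + .C 20, fun x => ?_⟩ hf
  have h := rewrites_drop (Code.toTree x.1) (enc x.2)
  have e := size_prod x
  exact Rewrites.mono (Rewrites.case_true h) (by simp [size] at e ⊢; omega)

theorem cons {f : α → β} {g : α → List β} (hf : PolyTime f) (hg : PolyTime g) :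
    PolyTime fun x => f x :: g x :=
  pair hf hg

theorem eq [DecidableEq β] {f g : α → β} (hf : PolyTime f) (hg : PolyTime g) :
    PolyTime fun x => decide (f x = g x) := by
  classical
  refine comp (g := fun y : β × β => decide (y.1 = y.2)) ⟨.case .main .skip .skip eqTest,
    .C 20 * .X + .C 30, fun x => ?_⟩ (hf.pair hg)
  have h := rewrites_eqTest (Code.toTree x.1) (Code.toTree x.2)
  have e : decide (Code.toTree x.1 = Code.toTree x.2) = decide (x.1 = x.2) :=
    decide_eq_decide.2 Code.toTree_injective.eq_iff
  rw [e] at h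
  have e := size_prod x
  exact Rewrites.mono (Rewrites.case_true h) (by simp [size] at e ⊢; omega)

/-- The condition is evaluated on a copy of the argument. Its code starts with the truth value. -/
theorem cond {c : α → Bool} {f g : α → β} (hc : PolyTime c) (hf : PolyTime f) (hg : PolyTime g) :
    PolyTime fun x => bif c x then f x else g x := by
  obtain ⟨p, q, h⟩ := hf
  obtain ⟨p', q', h'⟩ := hg
  obtain ⟨p₀, q₀, h₀⟩ := hc
  refine ⟨dup ;; p₀ ;; .case .main .skip p' (.case .main .skip (.case .main .skip p .skip) .skip),
    .C 12 * .X + q₀ + q + q' + .C 8, fun x => ?_⟩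
  refine ((rewrites_dup (Code.toTree x)).seq (((h₀ x).append _).seq
    (t := q.eval (size x) + q'.eval (size x) + 3) ?_)).mono ?_
  · rcases hcx : c x
    · have := Rewrites.case_false (p := .skip) (q := p')
        (r := .case .main .skip (.case .main .skip p .skip) .skip) (h' x)
      simp only [hcx, cond_false]
      exact this.mono (by omega)
    · have := Rewrites.case_true (p := .skip) (q := p')
        (Rewrites.case_false (p := .skip) (r := .skip)
          (Rewrites.case_false (p := .skip) (r := .skip) (h x)))
      simp only [hcx, cond_true]
      exact this.mono (by omega)
  · simp [size]; omega

/-- Definition by cases on a list. The code of a nonempty list, without its first symbol, consists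
of the codes of the head and of the tail; two more symbols make it a triple with the argument. -/
theorem listCases {l : α → List β} {f : α → γ} {g : α × β × List β → γ} (hl : PolyTime l)
    (hf : PolyTime f) (hg : PolyTime g) :
    PolyTime fun x => (match l x with | [] => f x | y :: m => g (x, y, m) : γ) := by
  obtain ⟨b, hb⟩ := hl.size_le
  obtain ⟨p, q, h⟩ := hf
  obtain ⟨p', q', h'⟩ := hg
  obtain ⟨p₀, q₀, h₀⟩ := hl
  refine ⟨dup ;; p₀ ;; .case .main .skip p (.push .main true ;; swap ;; .push .main true ;; p'),
    .C 19 * .X + q₀ + q + q'.comp (.X + b + 1) + .C 7 * b + .C 20, fun x => ?_⟩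
  refine ((rewrites_dup (Code.toTree x)).seq (((h₀ x).append _).seq
    (t := q.eval (size x) + (q'.comp (.X + b + 1)).eval (size x) + 7 * b.eval (size x) +
      7 * size x + 14) ?_)).mono ?_
  · have hb := hb x
    rcases hlx : l x with _ | ⟨y, m⟩
    · have := Rewrites.case_false (p := .skip)
        (r := .push .main true ;; swap ;; .push .main true ;; p') (h x)
      simp only [hlx]
      exact this.mono (by omega)
    · have h := (Rewrites.push true (enc y ++ enc m ++ enc x)).seq
        ((rewrites_swap (Code.toTree (y, m)) (Code.toTree x)).seq
          ((Rewrites.push true _).seq (h' (x, y, m))))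
      rw [hlx, size_cons] at hb
      simp only [hlx]
      refine (Rewrites.case_true (p := .skip) (q := p) h).mono ?_
      have := eval_mono q' (show size (x, y, m) ≤ size x + b.eval (size x) + 1 by
        simp at hb ⊢; omega)
      have e := size_prod (y, m)
      simp [size] at this hb e ⊢
      omega
  · simp [size]; omega

end PolyTime

/-! ### Recursion on lists in polynomial time -/

/-- Left fold over a list, where each step also sees the rest of the list. -/
def foldTails {α β : Type} (f : β → α → List α → β) : List α → β → β
  | [], b => b
  | a :: l, b => foldTails f l (f b a l)

theorem foldTails_eq_foldl {α β : Type} (f : β → α → β) (l : List α) (b : β) :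
    foldTails (fun b a _ => f b a) l b = l.foldl f b := by
  induction l generalizing b with
  | nil => rfl
  | cons a l ih => exact ih _

/-- Runs `p` as long as the list in the pair on top of `main` is not empty. Stack `c` holds a symbol
if the list has still to be inspected. -/
def whileCons (p : Prog) : Prog :=
  .loop .c .skip (.case .main .skip .skip (.case .main .skip (.push .main false ;; .push .main true)
    (.push .main true ;; .push .main true ;; p ;; .push .c true)))

namespace PolyTime

variable {α β γ δ : Type} [Code α] [Code β] [Code γ] [Code δ]

theorem runLe_whileCons {p : Prog} {f : δ → α → List α → δ} {t : ℕ} (I : List α → δ → Prop)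
    (hI : ∀ a l d, I (a :: l) d → I l (f d a l))
    (h : ∀ a l d, I (a :: l) d → Rewrites p (enc (a :: l, d)) (enc (l, f d a l)) t)
    (l : List α) (d : δ) (hd : I l d) (r : List Bool) :
    RunLe (whileCons p) ⟨enc (l, d) ++ r, [], [], [true]⟩
      ⟨enc (([] : List α), foldTails f l d) ++ r, [], [], []⟩ ((l.length + 1) * (t + 10)) := by
  induction l generalizing d with
  | nil =>
    exact RunLe.mono (t := 2 + 1 + 1 + 1 + 1) (.loopCons (x := true) rfl
      (.caseCons (x := true) rfl (.caseCons (x := false) rfl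
        ((RunLe.push .main false _).seq (.push .main true _)))) (.loopNil rfl)) (by simp)
  | cons a l ih =>
    refine RunLe.mono (t := 1 + (1 + (t + 1)) + 1 + 1 + (l.length + 1) * (t + 10) + 1)
      (.loopCons (x := true) rfl (.caseCons (x := true) rfl (.caseCons (x := true) rfl
        ((RunLe.push .main true _).seq ((RunLe.push .main true _).seq
          ((h a l d hd r).seq (.push .c true _))))))
        (ih _ (hI _ _ _ hd))) ?_
    simp [add_mul]; omega

/-- Recursion on a list, the sizes of the intermediate results being bounded through an invariant
`I x l b`, in which `l` is what remains of the list. -/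
theorem foldTails_of_invariant {l : γ → List α} {b : γ → β} {f : γ → β → α → List α → β}
    (hl : PolyTime l) (hb : PolyTime b)
    (hf : PolyTime fun p : (γ × β) × α × List α => f p.1.1 p.1.2 p.2.1 p.2.2)
    (I : γ → List α → β → Prop) (q : Polynomial ℕ) (h₀ : ∀ x, I x (l x) (b x))
    (hs : ∀ x b a l, I x (a :: l) b → I x l (f x b a l))
    (hq : ∀ x l b, I x l b → size b ≤ q.eval (size x)) :
    PolyTime fun x => foldTails (f x) (l x) (b x) := by
  have hstep : PolyTime fun s : List α × γ × β =>
      (match s.1 with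
        | [] => s
        | a :: l => (l, s.2.1, f s.2.1 s.2.2 a l) : List α × γ × β) := by
    refine listCases (g := fun y : (List α × γ × β) × α × List α =>
      (y.2.2, y.1.2.1, f y.1.2.1 y.1.2.2 y.2.1 y.2.2)) (fst id) id ?_
    refine pair (snd (snd id)) (pair (fst (snd (fst id))) ?_)
    exact hf.comp (f := fun y : (List α × γ × β) × α × List α =>
      ((y.1.2.1, y.1.2.2), y.2.1, y.2.2)) (pair (snd (fst id)) (snd id))
  have hinit := hl.pair (PolyTime.id.pair hb)
  obtain ⟨bl, hbl⟩ := hl.size_le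
  obtain ⟨p, u, h⟩ := hstep
  obtain ⟨p₀, u₀, hp₀⟩ := hinit
  refine (snd (snd (β := List α) ?_) : PolyTime fun x =>
    (([] : List α), x, foldTails (f x) (l x) (b x)).2.2)
  -- the loop carries the rest of the list, the parameter and the result; `B` bounds their size
  let B : Polynomial ℕ := bl + .X + q + 2
  refine ⟨p₀ ;; .push .c true ;; whileCons p, u₀ + (bl + 1) * (u.comp B + 10) + 1, fun x => ?_⟩
  intro r
  have hw := runLe_whileCons (p := p) (f := fun (d : γ × β) a l => (d.1, f d.1 d.2 a l))
    (t := (u.comp B).eval (size x))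
    (fun m d => d.1 = x ∧ I x m d.2 ∧ m <:+ l x) ?_ ?_ (l x) (x, b x)
    ⟨rfl, h₀ x, List.suffix_rfl⟩ r
  · have e : ∀ m : List α, ∀ c : β,
        foldTails (fun (d : γ × β) a l => (d.1, f d.1 d.2 a l)) m (x, c) =
          (x, foldTails (f x) m c) := by
      intro m
      induction m with
      | nil => exact fun _ => rfl
      | cons a m ih => exact fun c => ih _
    rw [e] at hw
    refine ((hp₀ x r).seq ((RunLe.push .c true _).seq hw)).mono ?_
    have h₁ : (l x).length + 1 ≤ bl.eval (size x) + 1 := by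
      have := length_lt_size (l x)
      have := hbl x
      omega
    have := Nat.mul_le_mul_right ((u.comp B).eval (size x) + 10) h₁
    simp only [Polynomial.eval_add, Polynomial.eval_mul, Polynomial.eval_one,
      Polynomial.eval_ofNat]
    omega
  · rintro a m ⟨y, c⟩ ⟨hy, hi, hm⟩
    obtain rfl : y = x := hy
    exact ⟨rfl, hs _ _ _ _ hi, (List.suffix_cons a m).trans hm⟩
  · rintro a m ⟨y, c⟩ ⟨hy, hi, hm⟩
    obtain rfl : y = x := hy
    refine (h (a :: m, y, c)).mono ?_
    rw [Polynomial.eval_comp]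
    refine eval_mono u ?_
    have := size_le_of_suffix hm
    have := hbl y
    have := hq _ _ _ hi
    simp only [size_pair] at *
    simp only [ B, Polynomial.eval_add, Polynomial.eval_X, Polynomial.eval_ofNat]
    omega

/-- Recursion on a list where each step increases the size of the result only by an amount that is
polynomial in the size of the parameters. -/
theorem foldTails {l : γ → List α} {b : γ → β} {f : γ → β → α → List α → β}
    (hl : PolyTime l) (hb : PolyTime b)
    (hf : PolyTime fun p : (γ × β) × α × List α => f p.1.1 p.1.2 p.2.1 p.2.2)
    (q : Polynomial ℕ)
    (hq : ∀ x b a m, size (f x b a m) ≤ size b + q.eval (size x + size (a :: m))) :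
    PolyTime fun x => foldTails (f x) (l x) (b x) := by
  obtain ⟨bl, hbl⟩ := hl.size_le
  obtain ⟨bb, hbb⟩ := hb.size_le
  let Q : Polynomial ℕ := q.comp (.X + bl)
  -- each element that remains in the list is worth `Q (size x)` for the growth of the result
  refine foldTails_of_invariant hl hb hf
    (fun x m c => m <:+ l x ∧
      size c + m.length * Q.eval (size x) ≤ bb.eval (size x) + bl.eval (size x) * Q.eval (size x))
    (bb + bl * Q) (fun x => ⟨List.suffix_rfl, ?_⟩) (fun x c a m h => ⟨?_, ?_⟩) fun x m c h => ?_
  · have := length_lt_size (l x)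
    have := Nat.mul_le_mul_right (Q.eval (size x)) (show (l x).length ≤ bl.eval (size x) by
      have := hbl x; omega)
    have := hbb x
    omega
  · exact (List.suffix_cons a m).trans h.1
  · have h₁ := hq x c a m
    have h₂ := h.2
    have h₃ : q.eval (size x + size (a :: m)) ≤ Q.eval (size x) := by
      have := eval_mono q (show size x + size (a :: m) ≤ size x + bl.eval (size x) by
        have := size_le_of_suffix h.1
        have := hbl x
        omega)
      simpa [Q] using this
    simp only [List.length_cons, add_mul, one_mul] at h₂
    omega
  · have := h.2
    simp only [Polynomial.eval_add, Polynomial.eval_mul]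
    omega

theorem foldl {l : γ → List α} {b : γ → β} {f : γ → β → α → β}
    (hl : PolyTime l) (hb : PolyTime b)
    (hf : PolyTime fun p : (γ × β) × α => f p.1.1 p.1.2 p.2)
    (q : Polynomial ℕ) (hq : ∀ x b a, size (f x b a) ≤ size b + q.eval (size x + size a)) :
    PolyTime fun x => (l x).foldl (f x) (b x) := by
  have := foldTails (f := fun x b a _ => f x b a) hl hb
    (hf.comp (f := fun p : (γ × β) × α × List α => (p.1, p.2.1)) (pair (fst id) (fst (snd id)))) q
    fun x b a m => (hq x b a).trans (by
      have := eval_mono q (show size x + size a ≤ size x + size (a :: m) by rw [size_cons]; omega)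
      simpa using this)
  simpa only [foldTails_eq_foldl] using this

theorem reverse {l : γ → List α} (hl : PolyTime l) : PolyTime fun x => (l x).reverse := by
  have := foldl (f := fun _ b a => a :: b) hl (const []) (cons (snd id) (snd (fst id))) (.X)
    fun x b a => by
      simp only [size_cons, Polynomial.eval_X]
      have := size_pos x
      omega
  exact this.of_eq fun x => by simp

theorem foldr {l : γ → List α} {b : γ → β} {f : γ → α → β → β}
    (hl : PolyTime l) (hb : PolyTime b)
    (hf : PolyTime fun p : (γ × β) × α => f p.1.1 p.2 p.1.2)
    (q : Polynomial ℕ) (hq : ∀ x b a, size (f x a b) ≤ size b + q.eval (size x + size a)) :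
    PolyTime fun x => (l x).foldr (f x) (b x) := by
  have := foldl (f := fun x b a => f x a b) hl.reverse hb hf q hq
  simpa only [List.foldl_reverse] using this

theorem append {l m : γ → List α} (hl : PolyTime l) (hm : PolyTime m) :
    PolyTime fun x => l x ++ m x := by
  have := foldr (f := fun _ a b => a :: b) hl hm (cons (snd id) (snd (fst id))) (.X)
    fun x b a => by
      simp only [size_cons, Polynomial.eval_X]
      have := size_pos x
      omega
  exact this.of_eq fun x => by simp

theorem flatMap {l : γ → List α} {f : γ → α → List β} (hl : PolyTime l)
    (hf : PolyTime fun p : γ × α => f p.1 p.2) : PolyTime fun x => (l x).flatMap (f x) := by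
  obtain ⟨q, hq⟩ := hf.size_le
  have := foldr (f := fun x a b => f x a ++ b) hl (const [])
    (append (hf.comp (f := fun p : (γ × List β) × α => (p.1.1, p.2))
      (pair (fst (fst id)) (snd id))) (snd (fst id))) (q.comp (.X + 1)) fun x b a => by
      have h₁ := hq (x, a)
      have h₂ := size_append (f x a) b
      simp only [size_pair, Polynomial.eval_comp, Polynomial.eval_add, Polynomial.eval_X,
        Polynomial.eval_one] at *
      omega
  have e : ∀ x (m : List α), m.foldr (fun a b => f x a ++ b) [] = m.flatMap (f x) := by
    intro x m
    induction m with
    | nil => rfl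
    | cons a m ih => simp [ih]
  simpa only [e] using this

theorem map {l : γ → List α} {f : γ → α → β} (hl : PolyTime l)
    (hf : PolyTime fun p : γ × α => f p.1 p.2) : PolyTime fun x => (l x).map (f x) := by
  have := flatMap (f := fun x a => [f x a]) hl (cons hf (const []))
  exact this.of_eq fun x => List.map_eq_flatMap.symm

theorem filter {l : γ → List α} {f : γ → α → Bool} (hl : PolyTime l)
    (hf : PolyTime fun p : γ × α => f p.1 p.2) : PolyTime fun x => (l x).filter (f x) := by
  have := flatMap (f := fun x a => bif f x a then [a] else []) hl
    (cond hf (cons (snd id) (const [])) (const []))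
  have e : ∀ x (m : List α), m.flatMap (fun a => bif f x a then [a] else []) = m.filter (f x) := by
    intro x m
    induction m with
    | nil => rfl
    | cons a m ih => cases h : f x a <;> simp [h, ih]
  simpa only [e] using this

theorem and {f g : γ → Bool} (hf : PolyTime f) (hg : PolyTime g) :
    PolyTime fun x => f x && g x := by
  have := cond hf hg (const false)
  exact this.of_eq fun x => by simp

theorem not {f : γ → Bool} (hf : PolyTime f) : PolyTime fun x => !f x := by
  have := cond hf (const false) (const true)
  exact this.of_eq fun x => by simp

theorem any {l : γ → List α} {f : γ → α → Bool} (hl : PolyTime l)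
    (hf : PolyTime fun p : γ × α => f p.1 p.2) : PolyTime fun x => (l x).any (f x) := by
  classical
  exact (not (eq (filter hl hf) (const []))).of_eq fun x => by rw [Bool.eq_iff_iff]; simp

theorem all {l : γ → List α} {f : γ → α → Bool} (hl : PolyTime l)
    (hf : PolyTime fun p : γ × α => f p.1 p.2) : PolyTime fun x => (l x).all (f x) := by
  exact (not (any (f := fun x a => !f x a) hl (not hf))).of_eq fun x => by
    simp [List.not_any_eq_all_not]

end PolyTime

/-! ### From stack programs to machines that decide a problem -/

/-- Input symbols as triples of truth values. -/
def symbolBits : InputSymbol → Bool × Bool × Bool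
  | .bit b => (false, false, b)
  | .exponent b => (false, true, b)
  | .endRank => (true, false, false)
  | .endWord => (true, false, true)
  | .endList => (true, true, false)

instance : Code InputSymbol :=
  ⟨fun s => Code.toTree (symbolBits s), Code.toTree_injective.comp (by
    rintro ((_ | _) | (_ | _) | _ | _ | _) ((_ | _) | (_ | _) | _ | _ | _) h <;>
      first | rfl | simp [symbolBits] at h)⟩

theorem size_symbol_le (s : InputSymbol) : size s ≤ 11 := by
  rcases s with ((_ | _) | (_ | _) | _ | _ | _) <;> decide

/-- The labels of the machine that decides a problem with the program `p`: `inl (inl true)` starts,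
`inl (inl false)` reads an input symbol, `inl (inr s)` writes the code of the symbol `s`,
`inr (some l)` is a label of `p`, and `inr none` writes the output. -/
abbrev DecideLabel (p : Prog) : Type := (Bool ⊕ InputSymbol) ⊕ Option p.Label

/-- Pushes a list of symbols on `main` and continues with `q`. -/
def pushAllStmt {Λ : Type} : List Bool → MStmt Λ → MStmt Λ
  | [], q => q
  | b :: l, q => pushAllStmt l (.push (some .main) (fun _ => b) q)

theorem stepAux_pushAllStmt {Λ : Type} (l : List Bool) (q : MStmt Λ) (v i r a b c) :
    Turing.TM2.stepAux (pushAllStmt l q) v (machineStacks i ⟨r, a, b, c⟩) =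
      Turing.TM2.stepAux q v (machineStacks i ⟨l ++ r, a, b, c⟩) := by
  induction l generalizing q with
  | nil => rfl
  | cons x l ih =>
    rw [pushAllStmt, ih]
    exact congrArg (Turing.TM2.stepAux q v)
      (update_machineStacks i ⟨l ++ r, a, b, c⟩ .main (x :: (l ++ r)))

/-- The program of the machine that decides a problem with the program `p`. The input is moved to
`main` as a list of trees, in reverse; the truth value that `p` leaves there is moved to the output
stack `a`. -/
def decideStmt (p : Prog) : DecideLabel p → MStmt (DecideLabel p)
  | .inl (.inl true) => pushAllStmt (enc ([] : List InputSymbol)) (.goto fun _ => .inl (.inl false))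
  | .inl (.inl false) =>
    .pop none (fun _ (s : Option InputSymbol) => s) <| .goto fun
      | none => .inr (some p.entry)
      | some s => .inl (.inr s)
  | .inl (.inr s) => pushAllStmt (true :: enc s) (.goto fun _ => .inl (.inl false))
  | .inr (some l) => p.stmt (fun l => .inr (some l)) (.inr none) l
  | .inr none =>
    .pop (some .main) (fun _ (x : Option Bool) => x.map InputSymbol.bit) <|
    .branch (fun v => v == some (.bit true))
      (.pop (some .main) (fun v _ => v) <| .pop (some .main) (fun v _ => v) <|
        .push (some .a) (fun _ => true) <| .load (fun _ => none) .halt)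
      (.push (some .a) (fun _ => false) <| .load (fun _ => none) .halt)

theorem reaches_read (p : Prog) (i l : List InputSymbol) (v) :
    ∃ v', Reaches (decideStmt p) (2 * i.length + 1)
      ⟨some (.inl (.inl false)), v, machineStacks i ⟨enc l, [], [], []⟩⟩
      ⟨some (.inr (some p.entry)), v', machineStacks [] ⟨enc (i.reverse ++ l), [], [], []⟩⟩ := by
  induction i generalizing l v with
  | nil =>
    exact ⟨none, .one (congrArg (Turing.TM2.Cfg.mk _ _) (update_machineStacks_input [] [] _))⟩
  | cons s i ih =>
    have h₁ : Reaches (decideStmt p) 1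
        ⟨some (.inl (.inl false)), v, machineStacks (s :: i) ⟨enc l, [], [], []⟩⟩
        ⟨some (.inl (.inr s)), some s, machineStacks i ⟨enc l, [], [], []⟩⟩ :=
      .one (congrArg (Turing.TM2.Cfg.mk _ _) (update_machineStacks_input (s :: i) i _))
    have h₂ : Reaches (decideStmt p) 1
        ⟨some (.inl (.inr s)), some s, machineStacks i ⟨enc l, [], [], []⟩⟩
        ⟨some (.inl (.inl false)), some s, machineStacks i ⟨enc (s :: l), [], [], []⟩⟩ :=
      .one (stepAux_pushAllStmt _ _ _ _ _ _ _ _)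
    obtain ⟨v', h₃⟩ := ih (s :: l) (some s)
    refine ⟨v', ?_⟩
    have e : 2 * (s :: i).length + 1 = 1 + (1 + (2 * i.length + 1)) := by simp; omega
    rw [e, List.reverse_cons, List.append_assoc]
    exact h₁.trans (h₂.trans h₃)

theorem reaches_finish (p : Prog) (b : Bool) (v) :
    Reaches (decideStmt p) 1 ⟨some (.inr none), v, machineStacks [] ⟨enc b, [], [], []⟩⟩
      ⟨none, none, machineStacks [] ⟨[], [b], [], []⟩⟩ := by
  refine .one ?_
  cases b <;> refine congrArg (Turing.TM2.Cfg.mk _ _) (funext fun k => ?_) <;>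
    rcases k with _ | (_ | _ | _ | _) <;> rfl

/-- The machine that decides a problem with the program `p`. -/
noncomputable def decideMachine (p : Prog) : Turing.FinTM2 where
  K := Option Stack
  k₀ := none
  k₁ := some .a
  Γ := Alphabet
  Λ := DecideLabel p
  main := .inl (.inl true)
  σ := Option InputSymbol
  initialState := none
  Γk₀Fin := inferInstanceAs (Fintype InputSymbol)
  m := decideStmt p

theorem initList_decideMachine (p : Prog) (i : List InputSymbol) :
    Turing.initList (decideMachine p) i =
      ⟨some (.inl (.inl true)), none, machineStacks i ⟨[], [], [], []⟩⟩ := by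
  refine congrArg (Turing.TM2.Cfg.mk _ _) (funext fun k => ?_)
  rcases k with _ | (_ | _ | _ | _) <;> rfl

theorem haltList_decideMachine (p : Prog) (l : List Bool) :
    Turing.haltList (decideMachine p) l = ⟨none, none, machineStacks [] ⟨[], l, [], []⟩⟩ := by
  refine congrArg (Turing.TM2.Cfg.mk _ _) (funext fun k => ?_)
  rcases k with _ | (_ | _ | _ | _) <;> rfl

/-- A problem is decided by a Turing machine in polynomial time if the answer is a polynomial-time
function of the reversed encoding. -/
theorem nonempty_computable_of_polyTime {α : Type} (e : α → List InputSymbol) (d : α → Bool)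
    {f : List InputSymbol → Bool} (hf : PolyTime f) (h : ∀ x, f (e x).reverse = d x) :
    Nonempty (Turing.TM2ComputableInPolyTime e Computability.encodeBool d) := by
  obtain ⟨p, q, hp⟩ := hf
  refine ⟨⟨⟨decideMachine p, Equiv.refl InputSymbol, Equiv.refl Bool⟩,
    q.comp (.C 12 * .X + 1) + .C 2 * .X + 3, fun x => ?_⟩⟩
  have key : ∃ n ≤ (q.comp (.C 12 * .X + 1) + .C 2 * .X + 3).eval (e x).length,
      Reaches (decideStmt p) n ⟨some (.inl (.inl true)), none, machineStacks (e x) ⟨[], [], [], []⟩⟩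
        ⟨none, none, machineStacks [] ⟨[], [d x], [], []⟩⟩ := by
    have h₁ : Reaches (decideStmt p) 1
        ⟨some (.inl (.inl true)), none, machineStacks (e x) ⟨[], [], [], []⟩⟩
        ⟨some (.inl (.inl false)), none,
          machineStacks (e x) ⟨enc ([] : List InputSymbol), [], [], []⟩⟩ :=
      .one (stepAux_pushAllStmt _ _ _ _ _ _ _ _)
    obtain ⟨v, h₂⟩ := reaches_read p (e x) [] none
    obtain ⟨t, ht, h₃⟩ := hp ((e x).reverse ++ []) []
    rw [List.append_nil, List.append_nil] at h₃
    obtain ⟨v', h₄⟩ := h₃.reaches (M := decideStmt p) (emb := fun l => .inr (some l))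
      (exit := .inr none) (fun _ => rfl) [] v
    rw [List.append_nil, h x] at h₄
    rw [List.append_nil] at ht h₂
    refine ⟨_, ?_, h₁.trans (h₂.trans (h₄.trans (reaches_finish p (d x) v')))⟩
    have := size_le_of_forall_le (l := (e x).reverse) fun s _ => size_symbol_le s
    have := eval_mono q this
    simp [mul_comm] at this ht ⊢
    omega
  refine ⟨⟨key.choose, ?_⟩, key.choose_spec.1⟩
  let run (c : (decideMachine p).Cfg) := (flip bind (decideMachine p).step)^[key.choose] (some c)
  have he : List.map (Equiv.refl InputSymbol).invFun (e x) = e x := List.map_id _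
  exact (congrArg (fun i => run (Turing.initList (decideMachine p) i)) he).trans <|
    (congrArg run (initList_decideMachine p (e x))).trans <|
      Eq.trans key.choose_spec.2 (congrArg some (haltList_decideMachine p [d x]).symm)

/-! ### Folded graphs of subgroups of free groups -/

section Algorithm

variable {κ : Type}

/-- The inverse of a letter. -/
def invLetter (a : κ × Bool) : κ × Bool := (a.1, !a.2)

/-- The suffixes of a word. -/
def suffixes (w : List (κ × Bool)) : List (List (κ × Bool)) :=
  foldTails (fun b a l => (a :: l) :: b) w [[]]

@[simp] theorem invLetter_invLetter (a : κ × Bool) : invLetter (invLetter a) = a := by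
  simp [invLetter]

theorem mem_suffixes {r w : List (κ × Bool)} : r ∈ suffixes w ↔ r <:+ w := by
  have : ∀ b, r ∈ foldTails (fun b a l => (a :: l) :: b) w b ↔ (r ∈ b ∨ (r <:+ w ∧ r ≠ [])) := by
    induction w with
    | nil => intro b; simp +contextual [foldTails]
    | cons a w ih =>
      intro b
      rw [foldTails, ih, List.suffix_cons_iff, List.mem_cons]
      constructor
      · rintro ((rfl | h) | h)
        · exact .inr ⟨.inl rfl, by simp⟩
        · exact .inl h
        · exact .inr ⟨.inr h.1, h.2⟩
      · rintro (h | ⟨rfl | h, h'⟩)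
        · exact .inl (.inr h)
        · exact .inl (.inl rfl)
        · exact .inr ⟨h, h'⟩
  rw [suffixes, this, List.mem_singleton]
  by_cases h : r = [] <;> simp [h]

/-- An edge of a labelled graph: its source, its label, and its target. The vertices are words; the
word `r` stands for the coset `H r⁻¹` of the subgroup `H` that the graph describes, so the base
vertex is the empty word. -/
abbrev Edge (κ : Type) : Type := List (κ × Bool) × (κ × Bool) × List (κ × Bool)

variable [DecidableEq κ]

/-- Renames the vertex `z` to `y`. -/
def substVertex (z y x : List (κ × Bool)) : List (κ × Bool) := bif x = z then y else x

/-- Identifies the vertex `z` with `y` at both ends of an edge. -/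
def substEdge (z y : List (κ × Bool)) (e : Edge κ) : Edge κ :=
  (substVertex z y e.1, e.2.1, substVertex z y e.2.2)

/-- A cycle at the base vertex with label `w`: the path through the suffixes of `w`, with the
inverse edges, where the vertex `w` is identified with the base vertex. -/
def wordEdges (w : List (κ × Bool)) : List (Edge κ) :=
  (foldTails (fun b a l => (a :: l, a, l) :: (l, invLetter a, a :: l) :: b) w []).map
    (substEdge w [])

/-- The bouquet of cycles for a list of words. -/
def bouquet (vs : List (List (κ × Bool))) : List (Edge κ) := vs.flatMap wordEdges

/-- The pairs of different targets of two edges with the same source and the same label. The first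
component is never the base vertex, so that it may be renamed to the second. -/
def conflicts (E : List (Edge κ)) : List (List (κ × Bool) × List (κ × Bool)) :=
  E.flatMap fun e => (E.filter fun e' =>
    e'.1 = e.1 && (e'.2.1 = e.2.1 && (!decide (e'.2.2 = e.2.2) && !decide (e'.2.2 = [])))).map
      fun e' => (e'.2.2, e.2.2)

/-- Folds one pair of edges, if there is one to be folded. -/
def foldStep (E : List (Edge κ)) : List (Edge κ) :=
  match conflicts E with
  | [] => E
  | p :: _ => E.map (substEdge p.1 p.2)

/-- Folds a graph completely. Each step that does not fix the graph lowers the number of targets of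
edges, so as many steps as there are edges suffice. -/
def foldGraph (E : List (Edge κ)) : List (Edge κ) := E.foldl (fun E' _ => foldStep E') E

/-- Reads a letter from a state `(p, s)`, where `p` is a vertex and `s` is the path, last letter
first, that leads away from `p` into a tree outside the graph. -/
def readLetter (E : List (Edge κ)) (x : List (κ × Bool) × List (κ × Bool)) (a : κ × Bool) :
    List (κ × Bool) × List (κ × Bool) :=
  match x.2 with
  | [] =>
    match E.filter fun e => e.1 = x.1 && e.2.1 = a with
    | [] => (x.1, [a])
    | e :: _ => (e.2.2, [])
  | t :: s => bif t = invLetter a then (x.1, s) else (x.1, a :: x.2)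

/-- Reads a word from a state. -/
def readWord (E : List (Edge κ)) (x : List (κ × Bool) × List (κ × Bool)) (w : List (κ × Bool)) :
    List (κ × Bool) × List (κ × Bool) :=
  w.foldl (readLetter E) x

/-- The states that are reached from a vertex of the graph by a suffix of one of the words `us`. -/
def candidates (E : List (Edge κ)) (us : List (List (κ × Bool))) :
    List (List (κ × Bool) × List (κ × Bool)) :=
  ([] :: E.map fun e => e.2.2).flatMap fun p =>
    ([] :: us.flatMap suffixes).map fun s => readWord E (p, []) s

/-- Whether one of the candidates is fixed by all the words `us`. -/
def existsFixed (E : List (Edge κ)) (us : List (List (κ × Bool))) : Bool :=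
  (candidates E us).any fun x => us.all fun u => readWord E x u = x

/-- Decides whether the subgroup generated by `us` is conjugate into that generated by `vs`. -/
def decideIntoConj (us vs : List (List (κ × Bool))) : Bool :=
  existsFixed (foldGraph (bouquet vs)) us

/-! ### Folding -/

theorem mem_wordEdges {w : List (κ × Bool)} {e : Edge κ} : e ∈ wordEdges w ↔
    ∃ a l, a :: l <:+ w ∧ (e = substEdge w [] (a :: l, a, l) ∨
      e = substEdge w [] (l, invLetter a, a :: l)) := by
  have : ∀ (w : List (κ × Bool)) (e : Edge κ) (b : List (Edge κ)),
      e ∈ foldTails (fun b a l => (a :: l, a, l) :: (l, invLetter a, a :: l) :: b) w b ↔ (e ∈ b ∨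
      ∃ a l, a :: l <:+ w ∧ (e = (a :: l, a, l) ∨ e = (l, invLetter a, a :: l))) := by
    intro w e
    induction w with
    | nil => intro b; simp [foldTails]
    | cons a w ih =>
      intro b
      rw [foldTails, ih]
      simp only [List.mem_cons, List.suffix_cons_iff, List.cons.injEq]
      constructor
      · rintro ((h | h | h) | ⟨a', l, h, h'⟩)
        · exact .inr ⟨a, w, .inl ⟨rfl, rfl⟩, .inl h⟩
        · exact .inr ⟨a, w, .inl ⟨rfl, rfl⟩, .inr h⟩
        · exact .inl h
        · exact .inr ⟨a', l, .inr h, h'⟩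
      · rintro (h | ⟨a', l, ⟨rfl, rfl⟩ | h, h'⟩)
        · exact .inl (.inr (.inr h))
        · rcases h' with h' | h'
          · exact .inl (.inl h')
          · exact .inl (.inr (.inl h'))
        · exact .inr ⟨a', l, h, h'⟩
  simp only [wordEdges, List.mem_map, this, List.not_mem_nil, false_or]
  constructor
  · rintro ⟨_, ⟨a, l, h, rfl | rfl⟩, rfl⟩
    exacts [⟨a, l, h, .inl rfl⟩, ⟨a, l, h, .inr rfl⟩]
  · rintro ⟨a, l, h, rfl | rfl⟩
    exacts [⟨_, ⟨a, l, h, .inl rfl⟩, rfl⟩, ⟨_, ⟨a, l, h, .inr rfl⟩, rfl⟩]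

theorem mem_conflicts {E : List (Edge κ)} {p : List (κ × Bool) × List (κ × Bool)} :
    p ∈ conflicts E ↔
      (∃ x a, (x, a, p.1) ∈ E ∧ (x, a, p.2) ∈ E) ∧ p.1 ≠ p.2 ∧ p.1 ≠ [] := by
  simp only [conflicts, List.mem_flatMap, List.mem_map, List.mem_filter, Bool.and_eq_true,
    decide_eq_true_eq, Bool.not_eq_true', decide_eq_false_iff_not]
  constructor
  · rintro ⟨⟨x, a, y⟩, he, ⟨x', a', y'⟩, ⟨he', rfl, rfl, h₁, h₂⟩, rfl⟩
    exact ⟨⟨_, _, he', he⟩, h₁, h₂⟩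
  · rintro ⟨⟨x, a, h₁, h₂⟩, h₃, h₄⟩
    exact ⟨_, h₂, _, ⟨h₁, rfl, rfl, h₃, h₄⟩, rfl⟩

/-- A property that is preserved whenever a conflict is resolved holds for the folded graph. -/
theorem foldGraph_induction {P : List (Edge κ) → Prop} {E : List (Edge κ)}
    (hs : ∀ E p, p ∈ conflicts E → P E → P (E.map (substEdge p.1 p.2))) (h : P E) :
    P (foldGraph E) := by
  have step : ∀ E, P E → P (foldStep E) := by
    intro E h
    unfold foldStep
    rcases hc : conflicts E with _ | ⟨p, l⟩
    · exact h
    · exact hs E p (by simp [hc]) h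
  have : ∀ l : List (Edge κ), ∀ E, P E → P (l.foldl (fun E' _ => foldStep E') E) := by
    intro l
    induction l with
    | nil => exact fun _ h => h
    | cons e l ih => exact fun E h => ih _ (step E h)
  exact this E E h

theorem substVertex_ne {z y x : List (κ × Bool)} (h : x ≠ z) : substVertex z y x = x := by
  simp [substVertex, h]

theorem substVertex_self {z y : List (κ × Bool)} : substVertex z y z = y := by
  simp [substVertex]

/-- A folding step that resolves a conflict removes a vertex from the set of targets. -/
theorem conflicts_foldStep_iterate (n : ℕ) (E : List (Edge κ))
    (h : (E.map fun e => e.2.2).toFinset.card ≤ n) : conflicts (foldStep^[n] E) = [] := by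
  induction n generalizing E with
  | zero =>
    have : E = [] := by simpa using h
    subst this
    rfl
  | succ n ih =>
    rw [Function.iterate_succ_apply]
    rcases hc : conflicts E with _ | ⟨p, l⟩
    · have hE : foldStep E = E := by simp [foldStep, hc]
      rw [hE, Function.iterate_fixed hE, hc]
    · refine ih _ (Nat.le_of_lt_succ (lt_of_lt_of_le (Finset.card_lt_card ?_) h))
      obtain ⟨⟨x, a, h₁, h₂⟩, h₃, -⟩ := mem_conflicts.1 (show p ∈ conflicts E by simp [hc])
      have hE : foldStep E = E.map (substEdge p.1 p.2) := by simp [foldStep, hc]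
      have hsub : ∀ y ∈ (foldStep E).map (fun e => e.2.2),
          y ∈ E.map (fun e => e.2.2) ∧ y ≠ p.1 := by
        intro y hy
        simp only [hE, List.map_map, List.mem_map, Function.comp, substEdge] at hy
        obtain ⟨e, he, rfl⟩ := hy
        by_cases hep : e.2.2 = p.1
        · rw [hep, substVertex_self]
          exact ⟨List.mem_map.2 ⟨_, h₂, rfl⟩, h₃.symm⟩
        · rw [substVertex_ne hep]
          exact ⟨List.mem_map.2 ⟨_, he, rfl⟩, hep⟩
      refine (Finset.ssubset_iff_of_subset fun y hy => ?_).2 ⟨p.1, ?_, fun hp => ?_⟩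
      · exact List.mem_toFinset.2 (hsub y (List.mem_toFinset.1 hy)).1
      · exact List.mem_toFinset.2 (List.mem_map.2 ⟨_, h₁, rfl⟩)
      · exact (hsub _ (List.mem_toFinset.1 hp)).2 rfl

/-- A graph is folded if a vertex and a label determine at most one edge. -/
def IsFolded (E : List (Edge κ)) : Prop :=
  ∀ x a y z, (x, a, y) ∈ E → (x, a, z) ∈ E → y = z

theorem isFolded_foldGraph (E : List (Edge κ)) : IsFolded (foldGraph E) := by
  intro x a y z hy hz
  by_contra hyz
  have h : conflicts (foldGraph E) = [] := by
    have := conflicts_foldStep_iterate E.length E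
      ((List.toFinset_card_le _).trans (by rw [List.length_map]))
    rwa [← List.foldl_const] at this
  -- at least one of `y` and `z` is not the base vertex and may be renamed
  by_cases hy₀ : y = []
  · exact List.not_mem_nil (h ▸ mem_conflicts (p := (z, y)).2
      ⟨⟨x, a, hz, hy⟩, Ne.symm hyz, fun hz₀ => hyz (hy₀.trans hz₀.symm)⟩)
  · exact List.not_mem_nil (h ▸ mem_conflicts (p := (y, z)).2 ⟨⟨x, a, hy, hz⟩, hyz, hy₀⟩)

/-- A graph contains the inverses of its edges. -/
def IsSymm (E : List (Edge κ)) : Prop := ∀ x a y, (x, a, y) ∈ E → (y, invLetter a, x) ∈ E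

theorem IsSymm.map_substEdge {E : List (Edge κ)} (h : IsSymm E) (z y : List (κ × Bool)) :
    IsSymm (E.map (substEdge z y)) := by
  rintro x a x' hx
  obtain ⟨⟨u, b, u'⟩, hu, e⟩ := List.mem_map.1 hx
  simp only [substEdge, Prod.mk.injEq] at e
  obtain ⟨rfl, rfl, rfl⟩ := e
  exact List.mem_map.2 ⟨_, h _ _ _ hu, rfl⟩

theorem isSymm_bouquet (vs : List (List (κ × Bool))) : IsSymm (bouquet vs) := by
  intro x a y h
  obtain ⟨w, hw, h⟩ := List.mem_flatMap.1 h
  refine List.mem_flatMap.2 ⟨w, hw, ?_⟩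
  obtain ⟨b, l, hl, h | h⟩ := mem_wordEdges.1 h
  · simp only [substEdge, Prod.mk.injEq] at h
    obtain ⟨rfl, rfl, rfl⟩ := h
    exact mem_wordEdges.2 ⟨_, l, hl, .inr rfl⟩
  · simp only [substEdge, Prod.mk.injEq] at h
    obtain ⟨rfl, rfl, rfl⟩ := h
    exact mem_wordEdges.2 ⟨_, l, hl, .inl (by simp [substEdge])⟩

/-- There is a path with label `w` from `x` to `y`. -/
def IsPath (E : List (Edge κ)) : List (κ × Bool) → List (κ × Bool) → List (κ × Bool) → Prop
  | x, [], y => x = y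
  | x, a :: w, y => ∃ z, (x, a, z) ∈ E ∧ IsPath E z w y

theorem IsPath.map_substEdge {E : List (Edge κ)} {x w y : List (κ × Bool)} (h : IsPath E x w y)
    (z z' : List (κ × Bool)) :
    IsPath (E.map (substEdge z z')) (substVertex z z' x) w (substVertex z z' y) := by
  induction w generalizing x with
  | nil => exact congrArg _ h
  | cons a w ih =>
    obtain ⟨u, hu, h⟩ := h
    exact ⟨_, List.mem_map.2 ⟨_, hu, rfl⟩, ih h⟩

theorem isPath_bouquet {vs : List (List (κ × Bool))} {v : List (κ × Bool)} (hv : v ∈ vs) :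
    IsPath (bouquet vs) [] v [] := by
  have : ∀ w, w <:+ v → IsPath (bouquet vs) (substVertex v [] w) w [] := by
    intro w
    induction w with
    | nil =>
      intro _
      show substVertex v [] [] = []
      by_cases h : [] = v
      · rw [h, substVertex_self]
      · rw [substVertex_ne h]
    | cons a w ih =>
      intro h
      exact ⟨substVertex v [] w, List.mem_flatMap.2 ⟨v, hv, mem_wordEdges.2 ⟨a, w, h, .inl rfl⟩⟩,
        ih ((List.suffix_cons a w).trans h)⟩
  have h := this v List.suffix_rfl
  rwa [substVertex_self] at h

theorem isPath_foldGraph {vs : List (List (κ × Bool))} {v : List (κ × Bool)} (hv : v ∈ vs) :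
    IsPath (foldGraph (bouquet vs)) [] v [] := by
  refine foldGraph_induction (P := fun E => IsPath E [] v []) (fun E p hp h => ?_)
    (isPath_bouquet hv)
  have := h.map_substEdge p.1 p.2
  rwa [substVertex_ne (mem_conflicts.1 hp).2.2.symm] at this

theorem isSymm_foldGraph (vs : List (List (κ × Bool))) : IsSymm (foldGraph (bouquet vs)) :=
  foldGraph_induction (fun _ _ _ h => h.map_substEdge _ _) (isSymm_bouquet vs)

end Algorithm

/-! ### The action of words on states -/

section Action

variable {κ : Type}

/-- The path `s`, last letter first, is reduced and leaves the graph at once from the vertex `p`. -/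
def LeavesGraph (E : List (Edge κ)) (p : List (κ × Bool)) : List (κ × Bool) → Prop
  | [] => True
  | [a] => ∀ y, (p, a, y) ∉ E
  | a :: b :: s => a ≠ invLetter b ∧ LeavesGraph E p (b :: s)

theorem LeavesGraph.tail {E : List (Edge κ)} {p : List (κ × Bool)} {a : κ × Bool}
    {s : List (κ × Bool)} (h : LeavesGraph E p (a :: s)) : LeavesGraph E p s := by
  cases s with
  | nil => trivial
  | cons b s => exact h.2

variable [DecidableEq κ]

theorem readLetter_edge {E : List (Edge κ)} (hE : IsFolded E) {p y : List (κ × Bool)}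
    {a : κ × Bool} (h : (p, a, y) ∈ E) : readLetter E (p, []) a = (y, []) := by
  rcases hf : E.filter (fun e => e.1 = p && e.2.1 = a) with _ | ⟨⟨x, b, z⟩, l⟩
  · have := List.filter_eq_nil_iff.1 hf _ h
    simp at this
  · have : (x, b, z) ∈ E.filter (fun e => e.1 = p && e.2.1 = a) := by simp [hf]
    simp only [List.mem_filter, Bool.and_eq_true, decide_eq_true_eq] at this
    obtain ⟨hz, rfl, rfl⟩ := this
    simp only [readLetter, hf, hE _ _ _ _ h hz]

theorem readLetter_no_edge {E : List (Edge κ)} {p : List (κ × Bool)} {a : κ × Bool}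
    (h : ∀ y, (p, a, y) ∉ E) : readLetter E (p, []) a = (p, [a]) := by
  have : E.filter (fun e => e.1 = p && e.2.1 = a) = [] := by
    rw [List.filter_eq_nil_iff]
    rintro ⟨x, b, z⟩ he hx
    simp only [Bool.and_eq_true, decide_eq_true_eq] at hx
    obtain ⟨rfl, rfl⟩ := hx
    exact h _ he
  simp only [readLetter, this]

theorem readLetter_pop (E : List (Edge κ)) (p s : List (κ × Bool)) (a : κ × Bool) :
    readLetter E (p, invLetter a :: s) a = (p, s) := by
  simp [readLetter]

theorem readLetter_push (E : List (Edge κ)) (p s : List (κ × Bool)) {a t : κ × Bool}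
    (h : t ≠ invLetter a) : readLetter E (p, t :: s) a = (p, a :: t :: s) := by
  simp [readLetter, h]

theorem leavesGraph_readLetter {E : List (Edge κ)} (hE : IsFolded E)
    {x : List (κ × Bool) × List (κ × Bool)} (hx : LeavesGraph E x.1 x.2) (a : κ × Bool) :
    LeavesGraph E (readLetter E x a).1 (readLetter E x a).2 := by
  obtain ⟨p, _ | ⟨t, s⟩⟩ := x
  · by_cases h : ∃ y, (p, a, y) ∈ E
    · obtain ⟨y, h⟩ := h
      rw [readLetter_edge hE h]
      trivial
    · push Not at h
      rw [readLetter_no_edge h]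
      exact h
  · by_cases h : t = invLetter a
    · rw [h, readLetter_pop]
      exact hx.tail
    · rw [readLetter_push _ _ _ h]
      exact ⟨fun h' => h (by rw [h', invLetter_invLetter]), hx⟩

/-- Reading a letter and then its inverse has no effect. -/
theorem readLetter_invLetter {E : List (Edge κ)} (hE : IsFolded E) (hE' : IsSymm E)
    {x : List (κ × Bool) × List (κ × Bool)} (hx : LeavesGraph E x.1 x.2) (a : κ × Bool) :
    readLetter E (readLetter E x a) (invLetter a) = x := by
  have pop : ∀ p s, readLetter E (p, a :: s) (invLetter a) = (p, s) := by
    intro p s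
    have := readLetter_pop E p s (invLetter a)
    rwa [invLetter_invLetter] at this
  obtain ⟨p, _ | ⟨t, s⟩⟩ := x
  · by_cases h : ∃ y, (p, a, y) ∈ E
    · obtain ⟨y, h⟩ := h
      rw [readLetter_edge hE h, readLetter_edge hE (hE' _ _ _ h)]
    · push Not at h
      rw [readLetter_no_edge h, pop]
  · by_cases h : t = invLetter a
    · subst h
      rw [readLetter_pop]
      rcases s with _ | ⟨t, s⟩
      · exact readLetter_no_edge hx
      · exact readLetter_push _ _ _ fun h => hx.1 (by rw [h, invLetter_invLetter])
    · rw [readLetter_push _ _ _ h, pop]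

theorem readWord_append (E : List (Edge κ)) (x : List (κ × Bool) × List (κ × Bool))
    (w w' : List (κ × Bool)) : readWord E x (w ++ w') = readWord E (readWord E x w) w' :=
  List.foldl_append ..

theorem leavesGraph_readWord {E : List (Edge κ)} (hE : IsFolded E) (w : List (κ × Bool))
    {x : List (κ × Bool) × List (κ × Bool)} (hx : LeavesGraph E x.1 x.2) :
    LeavesGraph E (readWord E x w).1 (readWord E x w).2 := by
  induction w generalizing x with
  | nil => exact hx
  | cons a w ih => exact ih (leavesGraph_readLetter hE hx a)

/-- Words that represent the same element of the free group act in the same way. -/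
theorem readWord_eq_of_mk_eq {E : List (Edge κ)} (hE : IsFolded E) (hE' : IsSymm E)
    {x : List (κ × Bool) × List (κ × Bool)} (hx : LeavesGraph E x.1 x.2) {w w' : List (κ × Bool)}
    (h : FreeGroup.mk w = FreeGroup.mk w') : readWord E x w = readWord E x w' := by
  have hs : ∀ u v : List (κ × Bool), FreeGroup.Red.Step u v → readWord E x u = readWord E x v := by
    rintro _ _ ⟨⟩
    rename_i l₁ l₂ k b
    rw [readWord_append, readWord_append]
    exact congrArg (fun y => readWord E y l₂)
      (readLetter_invLetter hE hE' (leavesGraph_readWord hE l₁ hx) (k, b))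
  have hr : ∀ u v : List (κ × Bool), FreeGroup.Red u v → readWord E x u = readWord E x v := by
    intro u v h
    induction h with
    | refl => rfl
    | tail _ h ih => exact ih.trans (hs _ _ h)
  obtain ⟨u, h₁, h₂⟩ := FreeGroup.Red.exact.1 h
  exact (hr _ _ h₁).trans (hr _ _ h₂).symm

/-- As long as a state stays outside the graph, reading a word multiplies the path. -/
theorem readWord_outside (E : List (Edge κ)) (u : List (κ × Bool))
    {x : List (κ × Bool) × List (κ × Bool)} (h : ∀ w, w <+: u → (readWord E x w).2 ≠ []) :
    (readWord E x u).1 = x.1 ∧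
      FreeGroup.mk (readWord E x u).2.reverse = FreeGroup.mk x.2.reverse * FreeGroup.mk u := by
  induction u generalizing x with
  | nil => exact ⟨rfl, by simp [readWord]⟩
  | cons a u ih =>
    obtain ⟨h₁, h₂⟩ := ih (x := readLetter E x a) fun w hw =>
      h (a :: w) (List.cons_prefix_cons.2 ⟨rfl, hw⟩)
    have h₀ := h [] List.nil_prefix
    obtain ⟨p, _ | ⟨t, s⟩⟩ := x
    · exact absurd rfl h₀
    have hc : FreeGroup.mk (a :: u) = FreeGroup.mk [a] * FreeGroup.mk u := rfl
    have hr : readWord E (p, t :: s) (a :: u) = readWord E (readLetter E (p, t :: s) a) u := rfl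
    rw [hr, h₁, h₂, hc, ← mul_assoc]
    by_cases ht : t = invLetter a
    · subst ht
      rw [readLetter_pop]
      refine ⟨rfl, congrArg (fun y => y * FreeGroup.mk u) ?_⟩
      rw [FreeGroup.mul_mk, List.reverse_cons, List.append_assoc]
      exact (Quot.sound (by simpa [invLetter] using
        FreeGroup.Red.Step.not_rev (L₁ := s.reverse) (L₂ := []) (x := a.1) (b := a.2))).symm
    · rw [readLetter_push _ _ _ ht]
      exact ⟨rfl, congrArg (fun y => y * FreeGroup.mk u) (by rw [FreeGroup.mul_mk]; simp)⟩

theorem readWord_isPath {E : List (Edge κ)} (hE : IsFolded E) {p w y : List (κ × Bool)}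
    (h : IsPath E p w y) : readWord E (p, []) w = (y, []) := by
  induction w generalizing p with
  | nil => exact congrArg (·, []) h
  | cons a w ih =>
    obtain ⟨z, hz, h⟩ := h
    rw [← ih h, ← readLetter_edge hE hz]
    rfl

/-- A state that is reached from the base vertex has a vertex of the graph as its vertex. -/
theorem vertex_readWord_mem {E : List (Edge κ)} (w : List (κ × Bool))
    {x : List (κ × Bool) × List (κ × Bool)} (hx : x.1 ∈ [] :: E.map fun e => e.2.2) :
    (readWord E x w).1 ∈ [] :: E.map fun e => e.2.2 := by
  induction w generalizing x with
  | nil => exact hx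
  | cons a w ih =>
    refine ih ?_
    obtain ⟨p, _ | ⟨t, s⟩⟩ := x
    · rcases hf : E.filter (fun e => e.1 = p && e.2.1 = a) with _ | ⟨e, l⟩
      · simpa only [readLetter, hf] using hx
      · simp only [readLetter, hf]
        have : e ∈ E.filter (fun e => e.1 = p && e.2.1 = a) := by simp [hf]
        exact List.mem_cons_of_mem _ (List.mem_map.2 ⟨e, (List.mem_filter.1 this).1, rfl⟩)
    · by_cases h : t = invLetter a
      · rw [h, readLetter_pop]; exact hx
      · rw [readLetter_push _ _ _ h]; exact hx

end Action

/-! ### Correctness of the decision procedure -/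

section Correctness

variable {κ : Type}

/-- The subgroup generated by a list of words. -/
def wordsSubgroup (gens : List (List (κ × Bool))) : Subgroup (FreeGroup κ) :=
  Subgroup.closure {x | ∃ w ∈ gens, FreeGroup.mk w = x}

/-- `g⁻¹ H₁ g ≤ H₂` means that `H₁` fixes the coset `g H₂`. -/
theorem isConjInto_iff (us : List (List (κ × Bool))) (H : Subgroup (FreeGroup κ)) :
    IsConjInto (wordsSubgroup us) H ↔
      ∃ x : FreeGroup κ ⧸ H, ∀ u ∈ us, (FreeGroup.mk u)⁻¹ • x = x := by
  have key : ∀ g : FreeGroup κ, (wordsSubgroup us).map (MulAut.conj g⁻¹).toMonoidHom ≤ H ↔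
      ∀ u ∈ us, (FreeGroup.mk u)⁻¹ • (g : FreeGroup κ ⧸ H) = g := by
    intro g
    rw [Subgroup.map_le_iff_le_comap, wordsSubgroup, Subgroup.closure_le]
    constructor
    · intro h u hu
      have : g⁻¹ * FreeGroup.mk u * g ∈ H := by simpa using h ⟨u, hu, rfl⟩
      refine QuotientGroup.eq.2 ?_
      simpa [mul_assoc] using this
    · rintro h _ ⟨u, hu, rfl⟩
      have := QuotientGroup.eq.1 (h u hu)
      simpa [mul_assoc] using this
  constructor
  · rintro ⟨g, hg⟩
    exact ⟨g, (key g).1 hg⟩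
  · rintro ⟨x, hx⟩
    induction x using QuotientGroup.induction_on with
    | H g => exact ⟨g, (key g).2 hx⟩

/-- The coset of a state. Right cosets are replaced by their inverses, so that `a` acts on the left
as `a⁻¹`: the word `r` as a vertex stands for `r H`. -/
def cosetOf (H : Subgroup (FreeGroup κ)) (p : List (κ × Bool)) :
    List (κ × Bool) → FreeGroup κ ⧸ H
  | [] => (FreeGroup.mk p : FreeGroup κ)
  | a :: s => (FreeGroup.mk [a])⁻¹ • cosetOf H p s

/-- The edges of the graph are compatible with the action on the cosets of `H`. -/
def IsSound (H : Subgroup (FreeGroup κ)) (E : List (Edge κ)) : Prop :=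
  ∀ x a y, (x, a, y) ∈ E → (FreeGroup.mk [a])⁻¹ • cosetOf H x [] = cosetOf H y []

theorem inv_mk_invLetter (a : κ × Bool) :
    (FreeGroup.mk [invLetter a])⁻¹ = (FreeGroup.mk [a] : FreeGroup κ) := by
  rw [FreeGroup.inv_mk]
  simp [FreeGroup.invRev, invLetter]

theorem inv_mk_cons_smul (H : Subgroup (FreeGroup κ)) (a : κ × Bool) (l : List (κ × Bool)) :
    (FreeGroup.mk [a])⁻¹ • cosetOf H (a :: l) [] = cosetOf H l [] := by
  have : FreeGroup.mk (a :: l) = FreeGroup.mk [a] * FreeGroup.mk l := rfl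
  rw [cosetOf, cosetOf, this, MulAction.Quotient.smul_coe, smul_eq_mul, inv_mul_cancel_left]

variable [DecidableEq κ]

/-- A suffix `r` of a generator `v` stands for the coset of `r`, and `v` itself for that of `1`. -/
theorem isSound_bouquet (vs : List (List (κ × Bool))) :
    IsSound (wordsSubgroup vs) (bouquet vs) := by
  have hsubst : ∀ w ∈ vs, ∀ x, cosetOf (wordsSubgroup vs) (substVertex w [] x) [] =
      cosetOf (wordsSubgroup vs) x [] := by
    intro w hw x
    by_cases h : x = w
    · subst h
      rw [substVertex_self]
      refine QuotientGroup.eq.2 ?_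
      have : FreeGroup.mk x ∈ wordsSubgroup vs := Subgroup.subset_closure ⟨x, hw, rfl⟩
      simpa [← FreeGroup.one_eq_mk] using this
    · rw [substVertex_ne h]
  intro x a y h
  obtain ⟨w, hw, h⟩ := List.mem_flatMap.1 h
  obtain ⟨b, l, hl, h | h⟩ := mem_wordEdges.1 h
  · simp only [substEdge, Prod.mk.injEq] at h
    obtain ⟨rfl, rfl, rfl⟩ := h
    rw [hsubst w hw, hsubst w hw, inv_mk_cons_smul]
  · simp only [substEdge, Prod.mk.injEq] at h
    obtain ⟨rfl, rfl, rfl⟩ := h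
    rw [hsubst w hw, hsubst w hw, ← inv_mk_cons_smul _ b l, inv_mk_invLetter, smul_inv_smul]

/-- The targets of two edges with the same source and label have the same coset, so they may be
identified. -/
theorem isSound_foldGraph (vs : List (List (κ × Bool))) :
    IsSound (wordsSubgroup vs) (foldGraph (bouquet vs)) := by
  refine foldGraph_induction (fun E p hp h => ?_) (isSound_bouquet vs)
  obtain ⟨⟨x, a, h₁, h₂⟩, -⟩ := mem_conflicts.1 hp
  have hp : cosetOf (wordsSubgroup vs) p.1 [] = cosetOf (wordsSubgroup vs) p.2 [] :=
    (h _ _ _ h₁).symm.trans (h _ _ _ h₂)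
  have hsubst : ∀ x, cosetOf (wordsSubgroup vs) (substVertex p.1 p.2 x) [] =
      cosetOf (wordsSubgroup vs) x [] := by
    intro x
    by_cases h : x = p.1
    · rw [h, substVertex_self, hp]
    · rw [substVertex_ne h]
  intro x a y hx
  obtain ⟨⟨u, b, u'⟩, hu, e⟩ := List.mem_map.1 hx
  simp only [substEdge, Prod.mk.injEq] at e
  obtain ⟨rfl, rfl, rfl⟩ := e
  rw [hsubst, hsubst, h _ _ _ hu]

/-- Reading a word acts on the coset of a state. -/
theorem cosetOf_readWord {H : Subgroup (FreeGroup κ)} {E : List (Edge κ)} (hE : IsSound H E)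
    (w : List (κ × Bool)) (x : List (κ × Bool) × List (κ × Bool)) :
    cosetOf H (readWord E x w).1 (readWord E x w).2 =
      (FreeGroup.mk w)⁻¹ • cosetOf H x.1 x.2 := by
  induction w generalizing x with
  | nil => simp [readWord, ← FreeGroup.one_eq_mk]
  | cons a w ih =>
    have hc : FreeGroup.mk (a :: w) = FreeGroup.mk [a] * FreeGroup.mk w := rfl
    have hr : readWord E x (a :: w) = readWord E (readLetter E x a) w := rfl
    rw [hr, ih, hc, mul_inv_rev, mul_smul]
    congr 1
    obtain ⟨p, _ | ⟨t, s⟩⟩ := x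
    · rcases hf : E.filter (fun e => e.1 = p && e.2.1 = a) with _ | ⟨⟨x, b, z⟩, l⟩
      · simp only [readLetter, hf]
        rfl
      · have : (x, b, z) ∈ E.filter (fun e => e.1 = p && e.2.1 = a) := by simp [hf]
        simp only [List.mem_filter, Bool.and_eq_true, decide_eq_true_eq] at this
        obtain ⟨hz, rfl, rfl⟩ := this
        simp only [readLetter, hf]
        exact (hE _ _ _ hz).symm
    · by_cases h : t = invLetter a
      · subst h
        rw [readLetter_pop]
        show _ = _ • (FreeGroup.mk [invLetter a])⁻¹ • _
        rw [inv_mk_invLetter, inv_smul_smul]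
      · rw [readLetter_push _ _ _ h]
        rfl

/-- The elements of the subgroup that is generated by the labels of cycles fix the base state. -/
theorem readWord_base_of_mem {E : List (Edge κ)} {vs : List (List (κ × Bool))} (hE : IsFolded E)
    (hE' : IsSymm E) (hv : ∀ v ∈ vs, IsPath E [] v []) {w : List (κ × Bool)}
    (hw : FreeGroup.mk w ∈ wordsSubgroup vs) : readWord E ([], []) w = ([], []) := by
  have hx : LeavesGraph E ([] : List (κ × Bool)) [] := trivial
  have heq := fun {u v} => readWord_eq_of_mk_eq (w := u) (w' := v) hE hE' (x := ([], [])) hx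
  suffices ∀ h ∈ wordsSubgroup vs, ∀ w, FreeGroup.mk w = h → readWord E ([], []) w = ([], []) from
    this _ hw w rfl
  intro h hh
  induction hh using Subgroup.closure_induction with
  | mem _ hm =>
    obtain ⟨v, hv', rfl⟩ := hm
    exact fun w hw => (heq hw).trans (readWord_isPath hE (hv v hv'))
  | one => exact fun w hw => heq (hw.trans FreeGroup.one_eq_mk)
  | mul a b _ _ ha hb =>
    intro w hw
    rw [heq (v := a.toWord ++ b.toWord) (by
      rw [hw, ← FreeGroup.mul_mk, FreeGroup.mk_toWord, FreeGroup.mk_toWord]),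
      readWord_append, ha _ FreeGroup.mk_toWord, hb _ FreeGroup.mk_toWord]
  | inv a _ ha =>
    intro w hw
    have := heq (u := a.toWord ++ w) (v := []) (by
      rw [← FreeGroup.mul_mk, FreeGroup.mk_toWord, hw, mul_inv_cancel, FreeGroup.one_eq_mk])
    rwa [readWord_append, ha _ FreeGroup.mk_toWord] at this

theorem existsFixed_eq_true_iff {E : List (Edge κ)} {us : List (List (κ × Bool))} :
    existsFixed E us = true ↔ ∃ x ∈ candidates E us, ∀ u ∈ us, readWord E x u = x := by
  simp [existsFixed]

/-- A fixed state gives a fixed coset. Conversely, the state of a fixed coset is among the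
candidates: if some `u` is not trivial, the path of `u` from this state back to itself visits the
graph, as it would otherwise be contracted in a tree. -/
theorem decideIntoConj_iff (us vs : List (List (κ × Bool))) :
    decideIntoConj us vs = true ↔ IsConjInto (wordsSubgroup us) (wordsSubgroup vs) := by
  have hf := isFolded_foldGraph (bouquet vs)
  have hs := isSymm_foldGraph vs
  have hp := fun v (hv : v ∈ vs) => isPath_foldGraph hv
  have hc := isSound_foldGraph vs
  rw [decideIntoConj, existsFixed_eq_true_iff, isConjInto_iff]
  generalize foldGraph (bouquet vs) = E at *
  constructor
  · rintro ⟨x, -, hx⟩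
    refine ⟨cosetOf _ x.1 x.2, fun u hu => ?_⟩
    rw [← cosetOf_readWord hc, hx u hu]
  · rintro ⟨x, hx⟩
    induction x using QuotientGroup.induction_on with | H g => ?_
    have hbase : LeavesGraph E ([] : List (κ × Bool)) [] := trivial
    have heq := fun {u v} => readWord_eq_of_mk_eq (w := u) (w' := v) hf hs (x := ([], [])) hbase
    -- `H g⁻¹` is the fixed right coset, so reading `g⁻¹` from the base gives its state
    set w := (g⁻¹).toWord with hw
    have hwg : FreeGroup.mk w = g⁻¹ := FreeGroup.mk_toWord
    have hfix : ∀ u ∈ us, readWord E (readWord E ([], []) w) u = readWord E ([], []) w := by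
      intro u hu
      have h₁ : readWord E ([], []) (w ++ u ++ g.toWord) = ([], []) := by
        refine readWord_base_of_mem hf hs hp ?_
        have := QuotientGroup.eq.1 (hx u hu)
        rw [← FreeGroup.mul_mk, ← FreeGroup.mul_mk, hwg, FreeGroup.mk_toWord]
        simpa [mul_assoc] using this
      have h₂ := heq (u := w ++ u) (v := w ++ u ++ g.toWord ++ w) (by
        simp only [← FreeGroup.mul_mk, hwg, FreeGroup.mk_toWord]
        simp)
      rw [readWord_append _ _ _ w, h₁] at h₂
      rw [← readWord_append, h₂]
    -- if all the words are trivial, they fix every state, for example the base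
    by_cases hall : ∀ u ∈ us, FreeGroup.mk u = 1
    · refine ⟨([], []), List.mem_flatMap.2 ⟨[], by simp, List.mem_map.2 ⟨[], by simp, rfl⟩⟩,
        fun u hu => heq ((hall u hu).trans FreeGroup.one_eq_mk)⟩
    · push Not at hall
      obtain ⟨u, hu, hu₁⟩ := hall
      refine ⟨_, ?_, hfix⟩
      obtain ⟨u₁, ⟨u₂, rfl⟩, hnil⟩ : ∃ u₁, u₁ <+: u ∧
          (readWord E (readWord E ([], []) w) u₁).2 = [] := by
        by_contra! hcon
        have := (readWord_outside E u hcon).2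
        rw [hfix u hu] at this
        exact hu₁ (left_eq_mul.1 this)
      -- the fixed state is where the rest `u₂` of `u` leads from the vertex that `u₁` has reached
      have hfu := hfix _ hu
      rw [readWord_append] at hfu
      refine List.mem_flatMap.2 ⟨(readWord E (readWord E ([], []) w) u₁).1, ?_,
        List.mem_map.2 ⟨u₂, ?_, ?_⟩⟩
      · rw [← readWord_append]
        exact vertex_readWord_mem _ (by simp)
      · exact List.mem_cons_of_mem _ (List.mem_flatMap.2
          ⟨_, hu, mem_suffixes.2 (List.suffix_append _ _)⟩)
      · have e : ((readWord E (readWord E ([], []) w) u₁).1, []) =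
            readWord E (readWord E ([], []) w) u₁ := Prod.ext rfl hnil.symm
        rw [e, hfu]

end Correctness

/-! ### The decision procedure runs in polynomial time -/

namespace PolyTime

variable {κ γ : Type} [Code κ] [Code γ]

theorem size_bool_le (b : Bool) : size b ≤ 3 := by cases b <;> decide

theorem invLetter {a : γ → κ × Bool} (ha : PolyTime a) : PolyTime fun x => invLetter (a x) :=
  pair (fst ha) (not (snd ha))

theorem suffixes {w : γ → List (κ × Bool)} (hw : PolyTime w) :
    PolyTime fun x => suffixes (w x) :=
  foldTails (f := fun _ b a l => (a :: l) :: b) hw (const [[]])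
    (cons (cons (fst (snd id)) (snd (snd id))) (snd (fst id))) .X fun x b a m => by
      have := size_pos x
      rw [size_cons _ b, Polynomial.eval_X]
      omega

variable [DecidableEq κ]

theorem substVertex {z y x : γ → List (κ × Bool)} (hz : PolyTime z) (hy : PolyTime y)
    (hx : PolyTime x) : PolyTime fun i => substVertex (z i) (y i) (x i) :=
  cond (eq hx hz) hy hx

theorem substEdge {z y : γ → List (κ × Bool)} {e : γ → Edge κ} (hz : PolyTime z) (hy : PolyTime y)
    (he : PolyTime e) : PolyTime fun i => substEdge (z i) (y i) (e i) :=
  pair (substVertex hz hy (fst he)) (pair (fst (snd he)) (substVertex hz hy (snd (snd he))))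

theorem wordEdges {w : γ → List (κ × Bool)} (hw : PolyTime w) :
    PolyTime fun x => wordEdges (w x) := by
  refine map (f := fun x e => IntoConj.substEdge (w x) [] e) ?_
    (substEdge (hw.comp (fst id)) (const []) (snd id))
  refine foldTails
    (f := fun _ b a l => (a :: l, a, l) :: (l, IntoConj.invLetter a, a :: l) :: b) hw (const []) ?_
    (.C 10 * .X) fun x b a m => ?_
  · have ha := fst (snd (id (α := (γ × List (Edge κ)) × (κ × Bool) × List (κ × Bool))))
    have hl := snd (snd (id (α := (γ × List (Edge κ)) × (κ × Bool) × List (κ × Bool))))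
    exact cons (pair (cons ha hl) (pair ha hl)) (cons (pair hl (pair (invLetter ha) (cons ha hl)))
      (snd (fst id)))
  · have h₁ : size (IntoConj.invLetter a) ≤ size a + 2 := by
      have h₁ := size_prod a
      have h₂ := size_prod (IntoConj.invLetter a)
      have h₃ := size_bool_le (!a.2)
      have h₄ := size_pos a.2
      simp only [IntoConj.invLetter] at h₂ ⊢
      omega
    have h₂ := size_pos x
    simp only [size_cons, size_pair, Polynomial.eval_mul, Polynomial.eval_C, Polynomial.eval_X]
    omega

theorem bouquet {vs : γ → List (List (κ × Bool))} (h : PolyTime vs) :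
    PolyTime fun x => bouquet (vs x) :=
  flatMap (f := fun _ w => IntoConj.wordEdges w) h (wordEdges (snd id))

theorem conflicts {E : γ → List (Edge κ)} (hE : PolyTime E) :
    PolyTime fun x => conflicts (E x) := by
  refine flatMap (f := fun x (e : Edge κ) => ((E x).filter fun e' =>
    e'.1 = e.1 && (e'.2.1 = e.2.1 && (!decide (e'.2.2 = e.2.2) && !decide (e'.2.2 = [])))).map
      fun e' => (e'.2.2, e.2.2)) hE ?_
  refine map (f := fun (p : γ × Edge κ) (e' : Edge κ) => (e'.2.2, p.2.2.2)) ?_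
    (pair (snd (snd (snd id))) (snd (snd (snd (fst id)))))
  refine filter (f := fun (p : γ × Edge κ) (e' : Edge κ) => e'.1 = p.2.1 &&
    (e'.2.1 = p.2.2.1 && (!decide (e'.2.2 = p.2.2.2) && !decide (e'.2.2 = []))))
    (hE.comp (fst id)) ?_
  exact and (eq (fst (snd id)) (fst (snd (fst id))))
    (and (eq (fst (snd (snd id))) (fst (snd (snd (fst id)))))
      (and (not (eq (snd (snd (snd id))) (snd (snd (snd (fst id))))))
        (not (eq (snd (snd (snd id))) (const [])))))

theorem foldStep {E : γ → List (Edge κ)} (hE : PolyTime E) : PolyTime fun x => foldStep (E x) := by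
  refine (listCases (g := fun y : γ × (List (κ × Bool) × List (κ × Bool)) × List _ =>
    (E y.1).map (IntoConj.substEdge y.2.1.1 y.2.1.2)) (conflicts hE) hE ?_).of_eq fun x => by
      unfold IntoConj.foldStep
      cases IntoConj.conflicts (E x) <;> rfl
  refine map (f := fun (y : γ × (List (κ × Bool) × List (κ × Bool)) ×
    List (List (κ × Bool) × List (κ × Bool))) e => IntoConj.substEdge y.2.1.1 y.2.1.2 e)
    (hE.comp (fst id)) ?_
  exact substEdge (fst (fst (snd (fst id)))) (snd (fst (snd (fst id)))) (snd id)

/-- Folding does not create new vertices, so the size of the graph stays bounded. -/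
theorem foldGraph {E : γ → List (Edge κ)} (hE : PolyTime E) :
    PolyTime fun x => foldGraph (E x) := by
  refine comp (g := IntoConj.foldGraph (κ := κ)) ?_ hE
  have := foldTails_of_invariant (γ := List (Edge κ)) (f := fun _ b (_ : Edge κ) _ =>
    IntoConj.foldStep b) id id (foldStep (snd (fst id)))
    (fun E _ b => b.length = E.length ∧
      ∀ e ∈ b, size e.1 ≤ size E ∧ size e.2.1 ≤ size E ∧ size e.2.2 ≤ size E)
    (.X * (.C 3 * .X + 3) + 1) (fun E => ⟨rfl, fun e he => ?_⟩) (fun E b _ _ h => ?_)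
    fun E _ b h => ?_
  · exact this.of_eq fun E => foldTails_eq_foldl (fun b _ => IntoConj.foldStep b) E E
  · have := size_le_of_mem he
    have := size_prod e
    have := size_prod e.2
    omega
  · unfold IntoConj.foldStep
    rcases hc : IntoConj.conflicts b with _ | ⟨p, l⟩
    · exact h
    · refine ⟨(List.length_map _).trans h.1, fun e he => ?_⟩
      replace he : e ∈ b.map (IntoConj.substEdge p.1 p.2) := he
      obtain ⟨⟨x, a, -, h₂⟩, -⟩ := mem_conflicts.1 (show p ∈ IntoConj.conflicts b by simp [hc])
      have hp := (h.2 _ h₂).2.2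
      obtain ⟨e', he', rfl⟩ := List.mem_map.1 he
      have hs : ∀ y, size y ≤ size E → size (IntoConj.substVertex p.1 p.2 y) ≤ size E := by
        intro y hy
        by_cases h : y = p.1
        · rw [h, substVertex_self]; exact hp
        · rw [substVertex_ne h]; exact hy
      have := h.2 _ he'
      exact ⟨hs _ this.1, this.2.1, hs _ this.2.2⟩
  · have h₁ := size_le_of_forall_le (l := b) (b := 3 * size E + 2) fun e he => by
      have := h.2 e he
      have := size_prod e
      have := size_prod e.2
      omega
    have h₂ := length_lt_size E
    have h₃ := Nat.mul_le_mul_right (3 * size E + 3) h₂.le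
    rw [h.1, add_assoc (3 * size E) 2 1] at h₁
    norm_num at h₁
    simp only [Polynomial.eval_add, Polynomial.eval_mul, Polynomial.eval_C, Polynomial.eval_X,
      Polynomial.eval_ofNat, Polynomial.eval_one]
    omega

theorem readLetter {E : γ → List (Edge κ)} {s : γ → List (κ × Bool) × List (κ × Bool)}
    {a : γ → κ × Bool} (hE : PolyTime E) (hs : PolyTime s) (ha : PolyTime a) :
    PolyTime fun x => readLetter (E x) (s x) (a x) := by
  have hfilter : PolyTime fun x => (E x).filter fun e => e.1 = (s x).1 && e.2.1 = a x :=
    filter (f := fun x (e : Edge κ) => e.1 = (s x).1 && e.2.1 = a x) hE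
      (and (eq (fst (snd id)) (fst (hs.comp (fst id))))
        (eq (fst (snd (snd id))) (ha.comp (fst id))))
  refine (listCases (g := fun y : γ × (κ × Bool) × List (κ × Bool) =>
    bif y.2.1 = IntoConj.invLetter (a y.1) then ((s y.1).1, y.2.2)
    else ((s y.1).1, a y.1 :: (s y.1).2)) (snd hs)
    (listCases (g := fun y : γ × Edge κ × List (Edge κ) => (y.2.1.2.2, [])) hfilter
      (pair (fst hs) (cons ha (const []))) (pair (snd (snd (fst (snd id)))) (const [])))
    ?_).of_eq fun x => by
      unfold IntoConj.readLetter
      dsimp only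
      generalize s x = y
      obtain ⟨p, _ | ⟨t, l⟩⟩ := y
      · dsimp only
        generalize (E x).filter (fun e => decide (e.1 = p) && decide (e.2.1 = a x)) = m
        cases m <;> rfl
      · rfl
  have ha' := ha.comp (fst (id (α := γ × (κ × Bool) × List (κ × Bool))))
  have hs' := hs.comp (fst (id (α := γ × (κ × Bool) × List (κ × Bool))))
  exact cond (eq (fst (snd id)) (invLetter ha')) (pair (fst hs') (snd (snd id)))
    (pair (fst hs') (cons ha' (snd hs')))

theorem size_readLetter_le (E : List (Edge κ)) (x : List (κ × Bool) × List (κ × Bool))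
    (a : κ × Bool) : size (IntoConj.readLetter E x a) ≤ size x + 2 * (size E + size a) := by
  obtain ⟨p, _ | ⟨t, s⟩⟩ := x
  · rcases hf : E.filter (fun e => e.1 = p && e.2.1 = a) with _ | ⟨e, l⟩
    · have := size_pos E
      simp only [IntoConj.readLetter, hf, size_pair, size_cons, size_nil]
      omega
    · have he : e ∈ E.filter (fun e => e.1 = p && e.2.1 = a) := by simp [hf]
      have := size_le_of_mem (List.mem_filter.1 he).1
      have := size_prod e
      have := size_prod e.2
      simp only [IntoConj.readLetter, hf, size_pair, size_nil]
      omega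
  · have := size_pos E
    by_cases h : t = IntoConj.invLetter a
    · rw [h, readLetter_pop]
      simp only [size_pair, size_cons]
      omega
    · rw [readLetter_push _ _ _ h]
      simp only [size_pair, size_cons]
      omega

theorem readWord {E : γ → List (Edge κ)} {s : γ → List (κ × Bool) × List (κ × Bool)}
    {w : γ → List (κ × Bool)} (hE : PolyTime E) (hs : PolyTime s) (hw : PolyTime w) :
    PolyTime fun x => readWord (E x) (s x) (w x) := by
  obtain ⟨q, hq⟩ := hE.size_le
  refine foldl (f := fun x => IntoConj.readLetter (E x)) hw hs
    (readLetter (hE.comp (fst (fst id))) (snd (fst id)) (snd id))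
    (.C 2 * (q + .X)) fun x b a => (size_readLetter_le _ _ _).trans ?_
  have h₁ := hq x
  have h₂ := eval_mono q (show size x ≤ size x + size a by omega)
  simp only [Polynomial.eval_add, Polynomial.eval_mul, Polynomial.eval_C, Polynomial.eval_X] at *
  omega

theorem candidates {E : γ → List (Edge κ)} {us : γ → List (List (κ × Bool))} (hE : PolyTime E)
    (hus : PolyTime us) : PolyTime fun x => candidates (E x) (us x) := by
  refine flatMap (f := fun x p => ([] :: (us x).flatMap IntoConj.suffixes).map fun s =>
      IntoConj.readWord (E x) (p, []) s)
    (cons (const []) (map (f := fun _ e => e.2.2) hE (snd (snd (snd id))))) ?_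
  refine map (f := fun (y : γ × List (κ × Bool)) s => IntoConj.readWord (E y.1) (y.2, []) s)
    (cons (const []) (flatMap (f := fun _ => IntoConj.suffixes) (hus.comp (fst id))
      (suffixes (snd id)))) ?_
  exact readWord (hE.comp (fst (fst id))) (pair (snd (fst id)) (const [])) (snd id)

theorem existsFixed {E : γ → List (Edge κ)} {us : γ → List (List (κ × Bool))} (hE : PolyTime E)
    (hus : PolyTime us) : PolyTime fun x => existsFixed (E x) (us x) := by
  refine any (f := fun x s => (us x).all fun u => IntoConj.readWord (E x) s u = s)
    (candidates hE hus) ?_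
  refine all (f := fun (y : γ × List (κ × Bool) × List (κ × Bool)) u =>
    decide (IntoConj.readWord (E y.1) y.2 u = y.2)) (hus.comp (fst id)) ?_
  exact eq (readWord (hE.comp (fst (fst id))) (snd (fst id)) (snd id)) (snd (fst id))

theorem decideIntoConj {us vs : γ → List (List (κ × Bool))} (hus : PolyTime us)
    (hvs : PolyTime vs) : PolyTime fun x => decideIntoConj (us x) (vs x) :=
  existsFixed (foldGraph (bouquet hvs)) hus

end PolyTime

/-! ### Parsing the input -/

/-- Parses one symbol; the input is parsed from right to left. The state is the list of the lists of
words that have been read. Letters of the parsed words are indexed by binary numbers. At the end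
mark of the rank, a list of its own is opened that takes up the binary digits of the rank. -/
def parseStep (t : List (List (List (List Bool × Bool)))) :
    InputSymbol → List (List (List (List Bool × Bool)))
  | .bit b => t.modifyHead fun g => g.modifyHead fun w => w.modifyHead fun a => (b :: a.1, a.2)
  | .exponent b => t.modifyHead fun g => g.modifyHead fun w => ([], b) :: w
  | .endRank => [[([], true)]] :: t
  | .endWord => t.modifyHead fun g => [] :: g
  | .endList => [] :: t

/-- Parses a reversed input. -/
def parse (l : List InputSymbol) : List (List (List (List Bool × Bool))) := l.foldl parseStep []

/-- A word with letters indexed by numbers as a word with letters indexed by binary numbers. -/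
def binaryWord {n : ℕ} (w : List (Fin n × Bool)) : List (List Bool × Bool) :=
  w.map fun l => (Computability.encodeNat l.1, l.2)

/-- Binary digits are put in front of the index of the letter that was opened last. -/
theorem foldr_parseStep_encodeBinary (m : ℕ) (a : List Bool × Bool) (w g t) :
    (encodeBinary m).foldr (fun s t => parseStep t s) (((a :: w) :: g) :: t) =
      (((Computability.encodeNat m ++ a.1, a.2) :: w) :: g) :: t := by
  unfold encodeBinary
  induction Computability.encodeNat m with
  | nil => rfl
  | cons b l ih => rw [List.map_cons, List.foldr_cons, ih]; rfl

theorem foldr_parseStep_encodeWord {n : ℕ} (w : List (Fin n × Bool)) (g t) :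
    (encodeWord w).foldr (fun s t => parseStep t s) (g :: t) = (binaryWord w :: g) :: t := by
  unfold encodeWord
  rw [List.foldr_append]
  induction w with
  | nil => rfl
  | cons a w ih =>
    rw [List.flatMap_cons, List.foldr_append, ih, encodeLetter, List.foldr_append]
    show List.foldr _ ((((([], a.2) : List Bool × Bool) :: binaryWord w) :: g) :: t) _ = _
    rw [foldr_parseStep_encodeBinary, List.append_nil]
    rfl

theorem foldr_parseStep_encodeWords {n : ℕ} (ws : List (List (Fin n × Bool))) (t) :
    (encodeWords ws).foldr (fun s t => parseStep t s) t = ws.map binaryWord :: t := by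
  unfold encodeWords
  rw [List.foldr_append]
  induction ws with
  | nil => rfl
  | cons w ws ih =>
    rw [List.flatMap_cons, List.foldr_append, ih, foldr_parseStep_encodeWord]
    rfl

theorem parse_reverse_encodeIntoConjInput (I : IntoConjInput) :
    ∃ r, parse (encodeIntoConjInput I).reverse =
      [r, I.gens₁.map binaryWord, I.gens₂.map binaryWord] := by
  rw [parse, List.foldl_reverse, encodeIntoConjInput, List.foldr_append,
    foldr_parseStep_encodeWords, List.foldr_append, foldr_parseStep_encodeWords, List.foldr_append]
  exact ⟨_, foldr_parseStep_encodeBinary _ _ _ _ _⟩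

/-- The answer as a function of the reversed input. -/
def answer (l : List InputSymbol) : Bool :=
  decideIntoConj ((parse l).tail.headD []) ((parse l).tail.tail.headD [])

theorem answer_reverse_encodeIntoConjInput (I : IntoConjInput) :
    answer (encodeIntoConjInput I).reverse =
      decideIntoConj (I.gens₁.map binaryWord) (I.gens₂.map binaryWord) := by
  obtain ⟨r, hr⟩ := parse_reverse_encodeIntoConjInput I
  simp [answer, hr]

theorem size_modifyHead_le {α : Type} [Code α] {f : α → α} {k : ℕ}
    (h : ∀ a, size (f a) ≤ size a + k) (l : List α) : size (l.modifyHead f) ≤ size l + k := by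
  cases l with
  | nil => simp
  | cons a l =>
    have := h a
    rw [List.modifyHead_cons, size_cons, size_cons]
    omega

theorem size_parseStep_le (t : List (List (List (List Bool × Bool)))) (s : InputSymbol) :
    size (parseStep t s) ≤ size t + 10 := by
  cases s with
  | bit b =>
    refine size_modifyHead_le (fun g => size_modifyHead_le (fun w => size_modifyHead_le
      (fun a => ?_) w) g) t
    have := PolyTime.size_bool_le b
    have := size_prod a
    rw [size_pair, size_cons]
    omega
  | exponent b =>
    refine size_modifyHead_le (fun g => size_modifyHead_le (fun w => ?_) g) t
    have := PolyTime.size_bool_le b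
    rw [size_cons, size_pair, size_nil]
    omega
  | endRank =>
    have := PolyTime.size_bool_le true
    simp only [parseStep, size_cons, size_pair, size_nil]
    omega
  | endWord =>
    refine size_modifyHead_le (fun g => ?_) t
    rw [size_cons, size_nil]
    omega
  | endList =>
    rw [parseStep, size_cons, size_nil]
    omega

namespace PolyTime

variable {α γ : Type} [Code α] [Code γ]

theorem symbolBits {s : γ → InputSymbol} (hs : PolyTime s) :
    PolyTime fun x => symbolBits (s x) :=
  comp (g := IntoConj.symbolBits) ⟨.skip, .C 1, fun x => by
    rw [Polynomial.eval_C]; exact Rewrites.skip (enc x)⟩ hs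

theorem modifyHead {l : γ → List α} {f : γ → α → α} (hl : PolyTime l)
    (hf : PolyTime fun p : γ × α => f p.1 p.2) : PolyTime fun x => (l x).modifyHead (f x) :=
  (listCases (g := fun y : γ × α × List α => f y.1 y.2.1 :: y.2.2) hl (const [])
    (cons (hf.comp (pair (fst id) (fst (snd id)))) (snd (snd id)))).of_eq fun x => by
      cases l x <;> rfl

theorem tail {l : γ → List α} (hl : PolyTime l) : PolyTime fun x => (l x).tail :=
  (listCases (g := fun y : γ × α × List α => y.2.2) hl (const []) (snd (snd id))).of_eq fun x => by
    cases l x <;> rfl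

theorem headD {l : γ → List α} {d : γ → α} (hl : PolyTime l) (hd : PolyTime d) :
    PolyTime fun x => (l x).headD (d x) :=
  (listCases (g := fun y : γ × α × List α => y.2.1) hl hd (fst (snd id))).of_eq fun x => by
    cases l x <;> rfl

theorem parseStep {t : γ → List (List (List (List Bool × Bool)))} {s : γ → InputSymbol}
    (ht : PolyTime t) (hs : PolyTime s) : PolyTime fun x => parseStep (t x) (s x) := by
  have hb := symbolBits hs
  have hz := snd (snd hb)
  have hletter : PolyTime fun x => (t x).modifyHead fun g => g.modifyHead fun w =>
      ([], (IntoConj.symbolBits (s x)).2.2) :: w :=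
    modifyHead (f := fun x g => g.modifyHead fun w => ([], (IntoConj.symbolBits (s x)).2.2) :: w) ht
      (modifyHead (f := fun (y : γ × List (List (List Bool × Bool))) w =>
        ([], (IntoConj.symbolBits (s y.1)).2.2) :: w) (snd id)
        (cons (pair (const []) (hz.comp (fst (fst id)))) (snd id)))
  have hbit : PolyTime fun x => (t x).modifyHead fun g => g.modifyHead fun w =>
      w.modifyHead fun a => ((IntoConj.symbolBits (s x)).2.2 :: a.1, a.2) :=
    modifyHead (f := fun x g => g.modifyHead fun w =>
      w.modifyHead fun a => ((IntoConj.symbolBits (s x)).2.2 :: a.1, a.2)) ht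
      (modifyHead (f := fun (y : γ × List (List (List Bool × Bool))) w =>
        w.modifyHead fun a => ((IntoConj.symbolBits (s y.1)).2.2 :: a.1, a.2)) (snd id)
        (modifyHead (f := fun
          (y : (γ × List (List (List Bool × Bool))) × List (List Bool × Bool)) a =>
          ((IntoConj.symbolBits (s y.1.1)).2.2 :: a.1, a.2)) (snd id)
          (pair (cons (hz.comp (fst (fst (fst id)))) (fst (snd id))) (snd (snd id)))))
  have hword : PolyTime fun x => (t x).modifyHead fun g => [] :: g :=
    modifyHead (f := fun _ g => [] :: g) ht (cons (const []) (snd id))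
  refine (cond (fst hb) (cond (fst (snd hb)) (cons (const []) ht)
    (cond hz hword (cons (const [[([], true)]]) ht)))
      (cond (fst (snd hb)) hletter hbit)).of_eq fun x => ?_
  rcases s x with _ | _ | _ | _ | _ <;> rfl

theorem answer : PolyTime answer := by
  have h : PolyTime parse :=
    foldl (f := fun _ => IntoConj.parseStep) id (const []) (parseStep (snd (fst id)) (snd id)) 10
      fun x t s => by simpa using size_parseStep_le t s
  exact decideIntoConj (headD (tail h) (const [])) (headD (tail (tail h)) (const []))

end PolyTime

/-! ### Change of the alphabet -/

theorem IsConjInto.map {G G' : Type*} [Group G] [Group G'] (f : G →* G') {H K : Subgroup G}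
    (h : IsConjInto H K) : IsConjInto (H.map f) (K.map f) := by
  obtain ⟨g, h⟩ := h
  refine ⟨f g, ?_⟩
  rintro _ ⟨_, ⟨x, hx, rfl⟩, rfl⟩
  exact ⟨_, h ⟨x, hx, rfl⟩, by simp⟩

theorem map_wordsSubgroup {κ κ' : Type} (e : κ → κ') (gens : List (List (κ × Bool))) :
    (wordsSubgroup gens).map (FreeGroup.map e) =
      wordsSubgroup (gens.map fun w => w.map fun l => (e l.1, l.2)) := by
  rw [wordsSubgroup, wordsSubgroup, MonoidHom.map_closure]
  congr 1
  ext x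
  simp only [Set.mem_image, Set.mem_ofPred_eq, List.mem_map, exists_exists_and_eq_and]
  rfl

/-- An embedding of the alphabet embeds the free group as a retract, so it does not matter in which
of the two groups the conjugating element is sought. -/
theorem isConjInto_map_iff {κ κ' : Type} {e : κ → κ'} (he : Function.Injective e)
    (us vs : List (List (κ × Bool))) :
    IsConjInto (wordsSubgroup (us.map fun w => w.map fun l => (e l.1, l.2)))
      (wordsSubgroup (vs.map fun w => w.map fun l => (e l.1, l.2))) ↔
      IsConjInto (wordsSubgroup us) (wordsSubgroup vs) := by
  classical
  rw [← map_wordsSubgroup, ← map_wordsSubgroup]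
  refine ⟨fun h => ?_, fun h => IsConjInto.map _ h⟩
  let r : FreeGroup κ' →* FreeGroup κ :=
    FreeGroup.lift fun k => if h : ∃ i, e i = k then FreeGroup.of h.choose else 1
  have hr : r.comp (FreeGroup.map e) = MonoidHom.id _ := by
    ext i
    have h : ∃ j, e j = e i := ⟨i, rfl⟩
    have hc : h.choose = i := he h.choose_spec
    simp [r, hc]
  have := IsConjInto.map r h
  rwa [Subgroup.map_map, Subgroup.map_map, hr, Subgroup.map_id, Subgroup.map_id] at this

theorem decideIntoConj_binaryWord_iff {n : ℕ} (us vs : List (List (Fin n × Bool))) :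
    decideIntoConj (us.map binaryWord) (vs.map binaryWord) = true ↔
      IsConjInto (subgroupOfWords us) (subgroupOfWords vs) := by
  rw [decideIntoConj_iff]
  refine isConjInto_map_iff (e := fun i : Fin n => Computability.encodeNat i)
    (fun i j h => ?_) us vs
  have := congrArg Computability.decodeNat h
  simpa [Fin.val_inj] using this

end IntoConj

/-- One multi-stack Turing machine, running in polynomial time in the length of its input, decides
the subgroup into-conjugacy problem in all free groups of finite rank. -/
theorem mainTheorem8 :
    ∃ decision : IntoConjInput → Bool,
      (∀ I : IntoConjInput,
        decision I = true ↔ IsConjInto (subgroupOfWords I.gens₁) (subgroupOfWords I.gens₂)) ∧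
      Nonempty (Turing.TM2ComputableInPolyTime
        encodeIntoConjInput Computability.encodeBool decision) :=
  ⟨fun I => IntoConj.decideIntoConj (I.gens₁.map IntoConj.binaryWord)
      (I.gens₂.map IntoConj.binaryWord),
    fun I => IntoConj.decideIntoConj_binaryWord_iff I.gens₁ I.gens₂,
    IntoConj.nonempty_computable_of_polyTime _ _ IntoConj.PolyTime.answer
      IntoConj.answer_reverse_encodeIntoConjInput⟩
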